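/- \textbf{Definitions.} Let $S$ be a scheme. Let $\mathrm{ACF}/S$ be the category of algebraically closed fields $K$ together with a morphism $\operatorname{Spec}K\to S$ (morphisms: ring maps compatible with the maps to $S$). For a functor $F\colon(\mathrm{Sch}/S)^{op}\to\mathrm{Set}$ (for example an $S$-scheme, identified with its functor of points) let $F_F\colon\mathrm{ACF}/S\to\mathrm{Set}$, $K\mapsto F(\operatorname{Spec}K)$, be its restriction. A \emph{sur covering} is a surjective morphism of schemes which is locally of finite presentation. A \emph{P-morphism} from an $S$-scheme $Y$ to $F$ is a natural transformation $f\colon Y_F\to F_F$ for which there are a sur covering $g\colon Z\to Y$ over $S$ and a morphism $f'\colon Z\to F$ over $S$ with $f\circ g_F=f'_F$. $S$-schemes and P-morphisms form a category, whose isomorphisms are called P-isomorphisms; $F^{P}$ denotes the functor sending an $S$-scheme $Y$ to the set of P-morphisms $Y\to F$. For an $S$-scheme $W$, evaluation at the tautological point of $\operatorname{Spec} K$ identifies $(W^P)_F$ with $W_F$, and a morphism $\pi\colon F\to W^P$ extends to $\pi^P\colon F^P\to W^P$, sending $a\colon U_F\to F_F$ to the composition $U_F\to F_F\to (W^P)_F\simeq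 W_F$. A \emph{P-action} of a group $G$ on an $S$-scheme $X$ is a group homomorphism from $G$ to the group of P-automorphisms of $X$. A \emph{strong P-quotient} of $X$ by $G$ is a P-morphism $\pi\colon X\to W$ of $S$-schemes with $\pi\circ g=\pi$ for all $g\in G$ such that, for the induced map $\bar\pi\colon X^{P}/G\to W^{P}$ from the functor $U\mapsto X^{P}(U)/G$, the extension $\bar\pi^{P}\colon (X^{P}/G)^{P}\to W^{P}$ is an isomorphism. An affine $k$-variety is an affine scheme of finite type over $k$. \textbf{Theorem.} Let $k$ be a field, $G$ a finite group, and $X$ a scheme locally of finite type over $k$ with a P-action of $G$ (over $S=\operatorname{Spec}k$). Then $X$ has a strong P-quotient $X\to Y$ with $Y$ locally of finite type over $k$; if $X$ is of finite type over $k$, then $Y$ can moreover be taken of finite type over $k$. If $X$ is P-isomorphic to a countable disjoint union of affine $k$-varieties, then so is every strong P-quotient of $X$ by $G$. -/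

import Mathlib

open CategoryTheory CategoryTheory.Limits AlgebraicGeometry Opposite

universe v u

namespace PSchemes

/-! ### Geometric points -/

/-- An algebraically closed field `K` together with a morphism `Spec K ⟶ S`. -/
structure ACF (S : Scheme.{u}) where
  carrier : Type u
  [field : Field carrier]
  [isAlgClosed : IsAlgClosed carrier]
  str : Spec (CommRingCat.of carrier) ⟶ S

attribute [instance] ACF.field ACF.isAlgClosed

namespace ACF

variable {S : Scheme.{u}}

/-- Morphisms `K ⟶ L` are the ring homomorphisms `K →+* L` compatible with the maps to `S`. -/
@[ext]
structure Hom (K L : ACF S) where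
  map : K.carrier →+* L.carrier
  w : Spec.map (CommRingCat.ofHom map) ≫ K.str = L.str

instance : Category (ACF S) where
  Hom := Hom
  id K := ⟨RingHom.id _, by simp⟩
  comp {K L M} φ ψ := ⟨ψ.map.comp φ.map, by
    rw [CommRingCat.ofHom_comp, Spec.map_comp, Category.assoc, φ.w, ψ.w]⟩

/-- The functor `(K, Spec K ⟶ S) ↦ Spec K` from `ACF/S` to `(Sch/S)ᵒᵖ`. -/
noncomputable def spec (S : Scheme.{u}) : ACF S ⥤ (Over S)ᵒᵖ where
  obj K := op (Over.mk K.str)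
  map {K L} φ := (Over.homMk (U := Over.mk L.str) (V := Over.mk K.str)
    (Spec.map (CommRingCat.ofHom φ.map)) φ.w).op
  map_id K := by
    apply Quiver.Hom.unop_inj
    ext1
    exact Spec.map_id _
  map_comp φ ψ := by
    apply Quiver.Hom.unop_inj
    ext1
    exact Spec.map_comp (CommRingCat.ofHom φ.map) (CommRingCat.ofHom ψ.map)

end ACF

variable {S : Scheme.{u}}

/-- The functor of points `T ↦ X(T) = Hom_S(T, X)` of an `S`-scheme `X`. The values are lifted to
`Type (u + 1)`, so that the functor `F ↦ F^P` below stays in one universe. -/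
noncomputable abbrev pts (X : Over S) : (Over S)ᵒᵖ ⥤ Type (u + 1) :=
  uliftYoneda.{u + 1}.obj X

/-- The morphism of functors of points induced by a morphism of `S`-schemes. -/
noncomputable abbrev ptsMap {X Y : Over S} (f : X ⟶ Y) : pts X ⟶ pts Y :=
  uliftYoneda.{u + 1}.map f

/-- The restriction `F_F` of a functor `F : (Sch/S)ᵒᵖ ⥤ Set` to algebraically closed fields. -/
noncomputable abbrev geom (F : (Over S)ᵒᵖ ⥤ Type (u + 1)) : ACF S ⥤ Type (u + 1) :=
  ACF.spec S ⋙ F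

/-- The restriction of a morphism of functors to algebraically closed fields. -/
noncomputable abbrev geomMap {F H : (Over S)ᵒᵖ ⥤ Type (u + 1)} (α : F ⟶ H) : geom F ⟶ geom H :=
  Functor.whiskerLeft (ACF.spec S) α

/-! ### P-morphisms -/

/-- A sur covering: a surjective morphism locally of finite presentation. -/
structure IsSurCovering {Z Y : Over S} (g : Z ⟶ Y) : Prop where
  locallyOfFinitePresentation : LocallyOfFinitePresentation g.left
  surjective : Surjective g.left

/-- A natural transformation `f : Y_F ⟶ F_F` is a P-morphism from the `S`-scheme `Y` to the
functor `F` if, after some sur covering `Z ⟶ Y`, it is induced by a morphism `Z ⟶ F`. -/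
def IsPMorphism {Y : Over S} {F : (Over S)ᵒᵖ ⥤ Type (u + 1)} (f : geom (pts Y) ⟶ geom F) : Prop :=
  ∃ (Z : Over S) (g : Z ⟶ Y) (f' : pts Z ⟶ F),
    IsSurCovering g ∧ geomMap (ptsMap g) ≫ f = geomMap f'

lemma IsSurCovering.id (Y : Over S) : IsSurCovering (𝟙 Y) where
  locallyOfFinitePresentation := by rw [Over.id_left]; infer_instance
  surjective := by rw [Over.id_left]; infer_instance

lemma IsSurCovering.comp {Z Y X : Over S} {g : Z ⟶ Y} {h : Y ⟶ X}
    (hg : IsSurCovering g) (hh : IsSurCovering h) : IsSurCovering (g ≫ h) := by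
  obtain ⟨_, _⟩ := hg
  obtain ⟨_, _⟩ := hh
  constructor <;> rw [Over.comp_left] <;> infer_instance

lemma IsSurCovering.exists_pullback {Z Y X : Over S} {g : Z ⟶ Y} (hg : IsSurCovering g)
    (h : X ⟶ Y) : ∃ (W : Over S) (p : W ⟶ X) (q : W ⟶ Z), IsSurCovering p ∧ p ≫ h = q ≫ g := by
  obtain ⟨_, _⟩ := hg
  refine ⟨Over.mk (pullback.fst h.left g.left ≫ X.hom), Over.homMk (pullback.fst h.left g.left),
    Over.homMk (pullback.snd h.left g.left) ?_, ⟨?_, ?_⟩, ?_⟩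
  · simp only [Over.mk_hom]
    rw [← Over.w g, ← pullback.condition_assoc, Over.w h]
  · exact inferInstanceAs (LocallyOfFinitePresentation (pullback.fst h.left g.left))
  · exact inferInstanceAs (Surjective (pullback.fst h.left g.left))
  · ext1
    simpa using pullback.condition

lemma IsPMorphism.of_hom {Y : Over S} {F : (Over S)ᵒᵖ ⥤ Type (u + 1)} (f : pts Y ⟶ F) :
    IsPMorphism (geomMap f) :=
  ⟨Y, 𝟙 Y, f, .id Y, by simp⟩

lemma IsPMorphism.comp {X Y : Over S} {F : (Over S)ᵒᵖ ⥤ Type (u + 1)}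
    {f : geom (pts X) ⟶ geom (pts Y)} {h : geom (pts Y) ⟶ geom F}
    (hf : IsPMorphism f) (hh : IsPMorphism h) : IsPMorphism (f ≫ h) := by
  obtain ⟨Z, g, f', hg, e⟩ := hf
  obtain ⟨Z', g', h', hg', e'⟩ := hh
  obtain ⟨f', rfl⟩ := uliftYoneda.{u + 1}.map_surjective f'
  obtain ⟨W, p, q, hp, epq⟩ := hg'.exists_pullback f'
  refine ⟨W, p ≫ g, ptsMap q ≫ h', hp.comp hg, ?_⟩
  have e₁ : geomMap (ptsMap p) ≫ geomMap (ptsMap f') = geomMap (ptsMap q) ≫ geomMap (ptsMap g') := by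
    simp only [ptsMap, geomMap, ← Functor.whiskerLeft_comp, ← Functor.map_comp, epq]
  calc geomMap (ptsMap (p ≫ g)) ≫ f ≫ h
      = geomMap (ptsMap p) ≫ (geomMap (ptsMap g) ≫ f) ≫ h := by simp
    _ = (geomMap (ptsMap p) ≫ geomMap (ptsMap f')) ≫ h := by rw [e, Category.assoc]
    _ = geomMap (ptsMap q) ≫ geomMap h' := by rw [e₁, Category.assoc, e']
    _ = geomMap (ptsMap q ≫ h') := by simp

/-- The functor `F^P`, sending an `S`-scheme `Y` to the set of P-morphisms `Y ⟶ F`. -/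
noncomputable def functorP (F : (Over S)ᵒᵖ ⥤ Type (u + 1)) : (Over S)ᵒᵖ ⥤ Type (u + 1) where
  obj Y := {f : geom (pts Y.unop) ⟶ geom F // IsPMorphism f}
  map h := TypeCat.ofHom fun f ↦
    ⟨geomMap (ptsMap h.unop) ≫ f.1, (IsPMorphism.of_hom (ptsMap h.unop)).comp f.2⟩
  map_id Y := by
    refine ConcreteCategory.hom_ext _ _ fun f ↦ ?_
    apply Subtype.ext
    change geomMap (ptsMap (𝟙 Y.unop)) ≫ f.1 = f.1
    simp
  map_comp h h' := by
    refine ConcreteCategory.hom_ext _ _ fun f ↦ ?_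
    apply Subtype.ext
    change geomMap (ptsMap (h'.unop ≫ h.unop)) ≫ f.1 =
      geomMap (ptsMap h'.unop) ≫ geomMap (ptsMap h.unop) ≫ f.1
    simp

/-! ### The category of P-schemes -/

variable (S) in
/-- The category `PSch/S`: its objects are the `S`-schemes, its morphisms the P-morphisms. -/
@[ext]
structure PSch where
  toOver : Over S

noncomputable instance : Category (PSch S) where
  Hom Y X := {f : geom (pts Y.toOver) ⟶ geom (pts X.toOver) // IsPMorphism f}
  id X := ⟨𝟙 _, by simpa using IsPMorphism.of_hom (𝟙 (pts X.toOver))⟩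
  comp f h := ⟨f.1 ≫ h.1, f.2.comp h.2⟩
  id_comp f := Subtype.ext (Category.id_comp f.1)
  comp_id f := Subtype.ext (Category.comp_id f.1)
  assoc f g h := Subtype.ext (Category.assoc f.1 g.1 h.1)

/-! ### Strong P-moduli spaces -/

/-- The canonical map `(X^P)_F ⟶ X_F`, sending a P-morphism `f : Spec K ⟶ X` to its value at the
tautological point of `(Spec K)(K)`. It is the inverse of the canonical map `X_F ⟶ (X^P)_F`. -/
noncomputable def evalId (F : (Over S)ᵒᵖ ⥤ Type (u + 1)) : geom (functorP F) ⟶ geom F where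
  app K := TypeCat.ofHom fun f ↦ f.1.app K ⟨𝟙 _⟩
  naturality K L φ := by
    ext f
    have h := ConcreteCategory.congr_hom (f.1.naturality φ) ⟨𝟙 _⟩
    refine Eq.trans ?_ h
    change (f.1.app L) ⟨𝟙 _ ≫ _⟩ = (f.1.app L) ⟨_ ≫ 𝟙 _⟩
    rw [Category.id_comp, Category.comp_id]

lemma geomMap_comp_evalId {Z : Over S} {F : (Over S)ᵒᵖ ⥤ Type (u + 1)} (β : pts Z ⟶ functorP F) :
    geomMap β ≫ evalId F = (β.app (op Z) ⟨𝟙 Z⟩).1 := by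
  ext K ⟨z⟩
  have h := ConcreteCategory.congr_hom (β.naturality z.op) ⟨𝟙 Z⟩
  have h' : β.app _ ⟨z⟩ = (functorP F).map z.op (β.app (op Z) ⟨𝟙 Z⟩) := by
    refine Eq.trans ?_ h
    change β.app _ ⟨z⟩ = β.app _ ⟨z ≫ 𝟙 _⟩
    rw [Category.comp_id]
  change (β.app _ ⟨z⟩).1.app K ⟨𝟙 _⟩ = _
  rw [h']
  change (β.app (op Z) ⟨𝟙 Z⟩).1.app K ⟨𝟙 _ ≫ z⟩ = _
  rw [Category.id_comp]
  rfl

/-- The unique extension `π^P : F^P ⟶ H^P` of a morphism `π : F ⟶ H^P`. It sends a P-morphism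
`a : U_F ⟶ F_F` to the composition of `a` with `F_F ⟶ (H^P)_F ≃ H_F`. -/
noncomputable def extendP {F H : (Over S)ᵒᵖ ⥤ Type (u + 1)} (π : F ⟶ functorP H) :
    functorP F ⟶ functorP H where
  app U := TypeCat.ofHom fun a ↦ ⟨a.1 ≫ geomMap π ≫ evalId H, by
    obtain ⟨Z, g, a', hg, e⟩ := a.2
    obtain ⟨Z', g', b, hg', e'⟩ := ((a' ≫ π).app (op Z) ⟨𝟙 Z⟩).2
    refine ⟨Z', g' ≫ g, b, hg'.comp hg, ?_⟩
    rw [← geomMap_comp_evalId] at e'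
    rw [← e']
    calc geomMap (ptsMap (g' ≫ g)) ≫ a.1 ≫ geomMap π ≫ evalId H
        = geomMap (ptsMap g') ≫ (geomMap (ptsMap g) ≫ a.1) ≫ geomMap π ≫ evalId H := by simp
      _ = _ := by rw [e]; simp⟩
  naturality U V h := by
    refine ConcreteCategory.hom_ext _ _ fun a ↦ ?_
    apply Subtype.ext
    change (geomMap (ptsMap h.unop) ≫ a.1) ≫ geomMap π ≫ evalId H =
      geomMap (ptsMap h.unop) ≫ a.1 ≫ geomMap π ≫ evalId H
    rw [Category.assoc]

/-- `π : F ⟶ X^P` exhibits the `S`-scheme `X` as a strong P-moduli space of `F` if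
`π^P : F^P ⟶ X^P` is an isomorphism. -/
def IsStrongPModuli {F : (Over S)ᵒᵖ ⥤ Type (u + 1)} {X : PSch S}
    (π : F ⟶ functorP (pts X.toOver)) : Prop :=
  IsIso (extendP π)

/-! ### Quotients by P-actions -/

/-- A P-action of `G` on `X`: a group homomorphism to the group of P-automorphisms of `X`.
(In `Aut X` the product `a * b` is `a ∘ b`.) -/
abbrev PAction (G : Type v) [Group G] (X : PSch S) : Type _ := G →* Aut X

variable {G : Type v} [Group G]

/-- Two elements of `X^P(U)`, that is, P-morphisms `U ⟶ X`, are related if they lie in the same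
`G`-orbit. -/
def orbitSetoid {X : PSch S} (ρ : PAction G X) (U : PSch S) : Setoid (U ⟶ X) where
  r a b := ∃ g : G, a ≫ (ρ g).hom = b
  iseqv :=
    { refl := fun a ↦ ⟨1, by rw [map_one]; exact Category.comp_id a⟩
      symm := by
        rintro a _ ⟨g, rfl⟩
        exact ⟨g⁻¹, by rw [map_inv, Category.assoc]; exact
          (congrArg (a ≫ ·) (ρ g).hom_inv_id).trans (Category.comp_id a)⟩
      trans := by
        rintro a _ _ ⟨g, rfl⟩ ⟨h, rfl⟩
        exact ⟨h * g, by rw [map_mul, Category.assoc]; rfl⟩ }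

/-- The functor `X^P/G : U ↦ X^P(U)/G`. -/
noncomputable def quotFunctor {X : PSch S} (ρ : PAction G X) : (Over S)ᵒᵖ ⥤ Type (u + 1) where
  obj U := Quotient (orbitSetoid ρ ⟨U.unop⟩)
  map h := TypeCat.ofHom <| Quotient.map ((functorP (pts X.toOver)).map h) <| by
    rintro a _ ⟨g, rfl⟩
    exact ⟨g, Subtype.ext (Category.assoc _ _ _)⟩
  map_id U := by
    ext ⟨a⟩
    exact congrArg (Quotient.mk (orbitSetoid ρ ⟨U.unop⟩))
      (ConcreteCategory.congr_hom ((functorP (pts X.toOver)).map_id U) a)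
  map_comp {U V W} h h' := by
    ext ⟨a⟩
    exact congrArg (Quotient.mk (orbitSetoid ρ ⟨W.unop⟩))
      (ConcreteCategory.congr_hom ((functorP (pts X.toOver)).map_comp h h') a)

/-- A P-morphism `π : X ⟶ W` is `G`-invariant if `π ∘ g = π` for all `g`. -/
def IsInvariant {X W : PSch S} (ρ : PAction G X) (π : X ⟶ W) : Prop :=
  ∀ g : G, (ρ g).hom ≫ π = π

/-- The morphism `X^P/G ⟶ W^P`, `[a] ↦ π ∘ a`, induced by a `G`-invariant P-morphism `π`. -/
noncomputable def quotMap {X W : PSch S} (ρ : PAction G X) (π : X ⟶ W) (hπ : IsInvariant ρ π) :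
    quotFunctor ρ ⟶ functorP (pts W.toOver) where
  app U := TypeCat.ofHom <| Quotient.lift (fun a : (⟨U.unop⟩ : PSch S) ⟶ X ↦ a ≫ π) <| by
    rintro a _ ⟨g, rfl⟩
    change a ≫ π = (a ≫ (ρ g).hom) ≫ π
    rw [Category.assoc, hπ g]
  naturality U V h := by
    ext ⟨a⟩
    exact Subtype.ext (Category.assoc _ _ _)

/-- A strong P-quotient of `X` by `G`: a `G`-invariant P-morphism `π : X ⟶ W` such that the induced
map `X^P/G ⟶ W^P` is a strong P-moduli space. -/
def IsStrongPQuotient {X W : PSch S} (ρ : PAction G X) (π : X ⟶ W) : Prop :=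
  ∃ hπ : IsInvariant ρ π, IsStrongPModuli (quotMap ρ π hπ)

/-! ### Countable disjoint unions of affine varieties -/

/-- The disjoint union of a family of `S`-schemes. -/
noncomputable def disjUnion {ι : Type u} (V : ι → Over S) : PSch S :=
  ⟨Over.mk (Sigma.desc fun i ↦ (V i).hom : (∐ fun i ↦ (V i).left) ⟶ S)⟩

/-- `X` is P-isomorphic to a countable disjoint union of affine varieties over the base (affine
schemes of finite type over the base, which is the spectrum of a field in the application). -/
def IsCountableUnionOfAffineVarieties (X : PSch S) : Prop :=
  ∃ (ι : Type u) (V : ι → Over S), Countable ι ∧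
    (∀ i, IsAffine (V i).left ∧ LocallyOfFiniteType (V i).hom) ∧
    Nonempty (X ≅ disjUnion V)

end PSchemes

/-! ### Lifting and descending geometric points -/

namespace PSchemes
variable {S : Scheme.{u}}

/-! P-morphisms only see geometric points, up to sur coverings. So it suffices to find a P-morphism
`π : X ⟶ W` whose fibres on `K`-points are the `G`-orbits and which has a section after a sur
covering of `W` (`IsGeometricQuotient`). Then `X^P/G` and `W^P` agree on geometric points. A
P-morphism to `W` lifts to `X` on a covering through the section, hence descends to a P-morphism to
`X^P/G`, so `W` is a strong P-quotient. Strong P-quotients are unique up to P-isomorphism, so the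
last assertion need only be checked for the quotient constructed here.

Subtracting from each member of an affine cover the earlier ones makes `X` P-isomorphic to a
disjoint union of affine varieties `V i` (`exists_iso_disjUnion`). The finitely many P-automorphisms
become honest morphisms `a g : Z ⟶ X` on one sur covering `Z`, which can be made quasi-compact over
`X` by compactness of the constructible topology. The finite set `J` of indices met by the orbit is
locally constant on `Z`. It cuts `Z` into quasi-compact clopen pieces, on each of which all `a g`
land in one affine variety.

On such a piece the orbit of a point is an unordered family of points in an affine variety.
Generators `b` of its coordinate ring turn this family into the polynomial `∏ g, (T - ∑ b, b(a g z)
X_b)`. By unique factorization into linear forms, the coefficients of this polynomial determine the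
family (`exists_separating_algHom`). They map the piece to an affine space, with constructible image
by Chevalley. A constructible set is the bijective image, even on field-valued points, of an affine
scheme of finite type (`isModelled_of_isConstructible`), and this scheme is the quotient of the
piece (`exists_affine_orbitSpace`). -/

lemma geomMap_ptsMap_apply {X Y : Over S} (f : X ⟶ Y) (K : ACF S) (x : Over.mk K.str ⟶ X) :
    (geomMap (ptsMap f)).app K ⟨x⟩ = (⟨x ≫ f⟩ : (geom (pts Y)).obj K) := rfl

/-- A nonempty scheme locally of finite type over an algebraically closed field has a rational
point. -/
lemma exists_section_of_isAlgClosed {K : Type u} [Field K] [IsAlgClosed K] {P : Scheme.{u}}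
    (q : P ⟶ Spec (.of K)) [LocallyOfFiniteType q] [Nonempty P] :
    ∃ s : Spec (.of K) ⟶ P, s ≫ q = 𝟙 _ := by
  have : JacobsonSpace P := LocallyOfFiniteType.jacobsonSpace q
  -- Closed points are dense in a Jacobson space, and over an algebraically closed field a closed
  -- point is rational.
  obtain ⟨x, -, hx⟩ := nonempty_inter_closedPoints (X := P) Set.univ_nonempty
    isClosed_univ.isLocallyClosed
  exact ⟨pointOfClosedPoint q x hx, pointOfClosedPoint_comp _ _ _⟩

/-- The fibre of `g` over `y` is nonempty and locally of finite type over `K`, hence has a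
`K`-point. -/
lemma exists_lift_of_isAlgClosed {K : Type u} [Field K] [IsAlgClosed K] {Z Y : Scheme.{u}}
    (g : Z ⟶ Y) [LocallyOfFiniteType g] (y : Spec (.of K) ⟶ Y)
    (hy : y (IsLocalRing.closedPoint K) ∈ Set.range g) :
    ∃ z : Spec (.of K) ⟶ Z, z ≫ g = y := by
  obtain ⟨z₀, hz₀⟩ := hy
  obtain ⟨x, -⟩ := Scheme.Pullback.exists_preimage_pullback _ _ hz₀
  have : Nonempty (pullback g y : Scheme.{u}) := ⟨x⟩
  obtain ⟨s, hs⟩ := exists_section_of_isAlgClosed (pullback.snd g y)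
  exact ⟨s ≫ pullback.fst _ _, by rw [Category.assoc, pullback.condition, reassoc_of% hs]⟩

/-- A sur covering is surjective on geometric points. -/
lemma IsSurCovering.surjective_app {Z Y : Over S} {g : Z ⟶ Y} (hg : IsSurCovering g) (K : ACF S) :
    Function.Surjective ((geomMap (ptsMap g)).app K) := by
  rintro ⟨(y : Over.mk K.str ⟶ Y)⟩
  obtain ⟨_, hg⟩ := hg
  obtain ⟨z, hz⟩ := exists_lift_of_isAlgClosed (K := K.carrier) g.left y.left (hg.surj _)
  refine ⟨⟨Over.homMk (U := Over.mk K.str) z ?_⟩, ?_⟩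
  · rw [← Over.w g, reassoc_of% hz]
    exact Over.w y
  · rw [geomMap_ptsMap_apply]
    exact congrArg ULift.up (Over.OverMorphism.ext hz)

/-- Natural transformations may be compared after a pointwise surjective transformation. -/
lemma hom_ext_of_surjective {E F H : ACF S ⥤ Type (u + 1)} (p : E ⟶ F)
    (hp : ∀ K, Function.Surjective (p.app K)) {a b : F ⟶ H} (h : p ≫ a = p ≫ b) : a = b := by
  ext K y
  obtain ⟨z, rfl⟩ := hp K y
  exact ConcreteCategory.congr_hom (NatTrans.congr_app h K) z

/-- A natural transformation out of `Z_F` which is constant on the fibres of a pointwise surjective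
transformation `p : Z_F ⟶ Y_F` descends along `p`. -/
lemma exists_descent {E F H : ACF S ⥤ Type (u + 1)} (p : E ⟶ F)
    (hp : ∀ K, Function.Surjective (p.app K)) (a : E ⟶ H)
    (h : ∀ K (x y : E.obj K), p.app K x = p.app K y → a.app K x = a.app K y) :
    ∃ b : F ⟶ H, p ≫ b = a := by
  -- The set-theoretic sections `s` need not be natural; constancy of `a` on the fibres of `p`
  -- repairs this.
  choose s hs using hp
  refine ⟨{ app K := TypeCat.ofHom fun y ↦ a.app K (s K y), naturality K L φ := ?_ }, ?_⟩
  · ext y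
    change a.app L (s L (F.map φ y)) = H.map φ (a.app K (s K y))
    rw [← NatTrans.naturality_apply]
    apply h
    rw [hs, NatTrans.naturality_apply, hs]
  · ext K x
    exact h _ _ _ (hs _ _)


/-! ### Geometric quotients -/

variable {G : Type v} [Group G]

/-- The morphism `Z ⟶ X^P/G` given by the class of a P-morphism `s : Z ⟶ X`. -/
noncomputable def orbitClass {X : PSch S} (ρ : PAction G X) {Z : Over S} (s : (⟨Z⟩ : PSch S) ⟶ X) :
    pts Z ⟶ quotFunctor ρ where
  app U := TypeCat.ofHom fun x ↦ (quotFunctor ρ).map x.down.op (Quotient.mk (orbitSetoid ρ ⟨Z⟩) s)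
  naturality U V h := by
    refine ConcreteCategory.hom_ext _ _ fun x ↦ ?_
    exact ConcreteCategory.congr_hom ((quotFunctor ρ).map_comp x.down.op h)
      (Quotient.mk (orbitSetoid ρ ⟨Z⟩) s)

lemma orbitClass_app_id {X : PSch S} (ρ : PAction G X) {Z : Over S} (s : (⟨Z⟩ : PSch S) ⟶ X) :
    (orbitClass ρ s).app (op Z) ⟨𝟙 Z⟩ = Quotient.mk (orbitSetoid ρ ⟨Z⟩) s :=
  ConcreteCategory.congr_hom ((quotFunctor ρ).map_id (op Z)) (Quotient.mk (orbitSetoid ρ ⟨Z⟩) s)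

/-- The map `(X^P/G)_F ⟶ W_F` induced by an invariant P-morphism. -/
noncomputable def orbitMap {X W : PSch S} (ρ : PAction G X) (π : X ⟶ W) (hπ : IsInvariant ρ π) :
    geom (quotFunctor ρ) ⟶ geom (pts W.toOver) :=
  geomMap (quotMap ρ π hπ) ≫ evalId _

lemma orbitClass_comp_orbitMap {X W : PSch S} (ρ : PAction G X) (π : X ⟶ W)
    (hπ : IsInvariant ρ π) {Z : Over S} (s : (⟨Z⟩ : PSch S) ⟶ X) :
    geomMap (orbitClass ρ s) ≫ orbitMap ρ π hπ = s.1 ≫ π.1 := by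
  have h := geomMap_comp_evalId (orbitClass ρ s ≫ quotMap ρ π hπ)
  have h' : (orbitClass ρ s ≫ quotMap ρ π hπ).app (op Z) ⟨𝟙 Z⟩ = s ≫ π := by
    change (quotMap ρ π hπ).app (op Z) ((orbitClass ρ s).app (op Z) ⟨𝟙 Z⟩) = _
    rw [orbitClass_app_id]
    rfl
  rw [h'] at h
  exact h

/-- A geometric point of `Spec K` is the image of the tautological one. -/
lemma exists_map_id_eq (K L : ACF S) (x : Over.mk L.str ⟶ Over.mk K.str) :
    ∃ φ : K ⟶ L, (geom (pts (Over.mk K.str))).map φ ⟨𝟙 _⟩ = ⟨x⟩ := by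
  obtain ⟨φ, hφ⟩ := Spec.map_surjective (R := .of K.carrier) (S := .of L.carrier) x.left
  have w : Spec.map φ ≫ K.str = L.str := (congrArg (· ≫ K.str) hφ).trans (Over.w x)
  refine ⟨⟨φ.hom, w⟩, ?_⟩
  exact congrArg ULift.up ((Category.comp_id (X := Over.mk L.str) (Y := Over.mk K.str)
    (Over.homMk (Spec.map φ) w)).trans (Over.OverMorphism.ext hφ))

/-- Natural transformations out of `(Spec K)_F` are determined by the tautological point. -/
lemma geom_hom_ext {K : ACF S} {H : ACF S ⥤ Type (u + 1)} {a b : geom (pts (Over.mk K.str)) ⟶ H}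
    (h : a.app K ⟨𝟙 _⟩ = b.app K ⟨𝟙 _⟩) : a = b := by
  ext L ⟨x⟩
  obtain ⟨φ, hφ⟩ := exists_map_id_eq K L x
  change a.app L ⟨x⟩ = b.app L ⟨x⟩
  rw [← hφ]
  exact ((NatTrans.naturality_apply a φ _).trans (congrArg (H.map φ) h)).trans
    (NatTrans.naturality_apply b φ _).symm

/-- A P-morphism `Spec K ⟶ X` is determined by its value at the tautological point, which is an
honest `K`-point of `X`. -/
lemma orbitClass_id_surjective {X : PSch S} (ρ : PAction G X) (K : ACF S) :
    Function.Surjective ((geomMap (orbitClass ρ (𝟙 X))).app K) := by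
  rintro ⟨a⟩
  refine ⟨a.1.app K ⟨𝟙 _⟩, congrArg (Quotient.mk (orbitSetoid ρ ⟨Over.mk K.str⟩)) ?_⟩
  refine Subtype.ext (geom_hom_ext ?_)
  exact congrArg ULift.up (Category.id_comp (a.1.app K ⟨𝟙 _⟩).down)

/-- A P-morphism `π : X ⟶ W` whose geometric fibres are the `G`-orbits and which has a section
after a sur covering of `W`. -/
structure IsGeometricQuotient {X W : PSch S} (ρ : PAction G X) (π : X ⟶ W) : Prop where
  apply_eq_iff (K : ACF S) (x y : (geom (pts X.toOver)).obj K) :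
    π.1.app K x = π.1.app K y ↔ ∃ g : G, (ρ g).hom.1.app K x = y
  exists_section : ∃ (Z : Over S) (q : Z ⟶ W.toOver) (s : (⟨Z⟩ : PSch S) ⟶ X),
    IsSurCovering q ∧ s.1 ≫ π.1 = geomMap (ptsMap q)

lemma IsGeometricQuotient.isStrongPQuotient {X W : PSch S} {ρ : PAction G X} {π : X ⟶ W}
    (h : IsGeometricQuotient ρ π) : IsStrongPQuotient ρ π := by
  have hπ : IsInvariant ρ π := by
    intro g
    apply Subtype.ext
    ext K x
    exact ((h.apply_eq_iff K _ _).mpr ⟨g, rfl⟩).symm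
  have hinj (K) : Function.Injective ((orbitMap ρ π hπ).app K) := by
    rintro ⟨a⟩ ⟨b⟩ hab
    obtain ⟨g, hg⟩ := (h.apply_eq_iff K (a.1.app K ⟨𝟙 _⟩) (b.1.app K ⟨𝟙 _⟩)).mp hab
    exact Quotient.sound ⟨g, Subtype.ext (geom_hom_ext hg)⟩
  refine ⟨hπ, ?_⟩
  rw [IsStrongPModuli, NatTrans.isIso_iff_isIso_app]
  rintro ⟨U⟩
  rw [isIso_iff_bijective]
  constructor
  · intro a b hab
    apply Subtype.ext
    ext K x
    apply hinj K
    exact ConcreteCategory.congr_hom (NatTrans.congr_app (congrArg Subtype.val hab) K) x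
  · rintro ⟨b, U', g, b', hg, e⟩
    obtain ⟨Z, q, s, hq, hs⟩ := h.exists_section
    obtain ⟨b', rfl⟩ := uliftYoneda.{u + 1}.map_surjective b'
    obtain ⟨U'', p, r, hp, epr⟩ := hq.exists_pullback b'
    let s' : (⟨U''⟩ : PSch S) ⟶ X := ⟨geomMap (ptsMap r) ≫ s.1, (IsPMorphism.of_hom _).comp s.2⟩
    -- On the covering `U''` of `U`, the section of `π` lifts `b` to the P-morphism `s'` into `X`.
    have e' : geomMap (ptsMap (p ≫ g)) ≫ b = geomMap (orbitClass ρ s') ≫ orbitMap ρ π hπ := by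
      rw [orbitClass_comp_orbitMap]
      calc geomMap (ptsMap (p ≫ g)) ≫ b = geomMap (ptsMap p) ≫ geomMap (ptsMap g) ≫ b := by simp
        _ = geomMap (ptsMap (p ≫ b')) := by rw [e]; simp
        _ = geomMap (ptsMap r) ≫ geomMap (ptsMap q) := by rw [epr]; simp
        _ = s'.1 ≫ π.1 := by rw [← hs, Category.assoc]
    -- Injectivity of `orbitMap` forces the orbit class of `s'` to depend only on the image point in
    -- `U`.
    obtain ⟨a, ha⟩ := exists_descent (geomMap (ptsMap (p ≫ g))) (hp.comp hg).surjective_app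
      (geomMap (orbitClass ρ s')) (by
        intro K x y hxy
        apply hinj K
        have e'' := ConcreteCategory.congr_hom (NatTrans.congr_app e' K)
        refine (e'' x).symm.trans (Eq.trans ?_ (e'' y))
        exact congrArg (b.app K) hxy)
    refine ⟨⟨a, U'', p ≫ g, orbitClass ρ s', hp.comp hg, ha⟩, Subtype.ext ?_⟩
    refine hom_ext_of_surjective _ (hp.comp hg).surjective_app ?_
    refine Eq.trans ?_ e'.symm
    exact (Category.assoc _ _ _).symm.trans (congrArg (· ≫ orbitMap ρ π hπ) ha)

/-! ### Uniqueness of strong P-quotients -/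

lemma IsStrongPModuli.bijective_app {F : (Over S)ᵒᵖ ⥤ Type (u + 1)} {X : PSch S}
    {π : F ⟶ functorP (pts X.toOver)} (h : IsStrongPModuli π) (U : Over S) :
    Function.Bijective ((extendP π).app (op U)) := by
  have : IsIso (extendP π) := h
  exact (isIso_iff_bijective _).mp (inferInstanceAs (IsIso ((extendP π).app (op U))))

/-- Surjectivity of `extendP` at `W` gives a preimage `σ` of the identity, and injectivity at `X`
makes `σ` a two-sided inverse, as in Yoneda's lemma. -/
lemma IsStrongPQuotient.exists_inverse {X W : PSch S} {ρ : PAction G X} {π : X ⟶ W}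
    (h : IsStrongPQuotient ρ π) : ∃ (hπ : IsInvariant ρ π)
    (σ : geom (pts W.toOver) ⟶ geom (quotFunctor ρ)), IsPMorphism σ ∧
      σ ≫ orbitMap ρ π hπ = 𝟙 _ ∧ orbitMap ρ π hπ ≫ σ = 𝟙 _ := by
  obtain ⟨hπ, h⟩ := h
  obtain ⟨⟨σ, hσP⟩, hσ⟩ := (h.bijective_app W.toOver).2 (𝟙 W : W ⟶ W)
  have hσ' : σ ≫ orbitMap ρ π hπ = 𝟙 _ := congrArg Subtype.val hσ
  refine ⟨hπ, σ, hσP, hσ', ?_⟩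
  have hc : geomMap (orbitClass ρ (𝟙 X)) ≫ orbitMap ρ π hπ = π.1 :=
    (orbitClass_comp_orbitMap ρ π hπ (𝟙 X)).trans (Category.id_comp _)
  have key : geomMap (orbitClass ρ (𝟙 X)) ≫ orbitMap ρ π hπ ≫ σ =
      geomMap (orbitClass ρ (𝟙 X)) := by
    rw [← Category.assoc, hc]
    have e : (π.1 ≫ σ) ≫ orbitMap ρ π hπ = geomMap (orbitClass ρ (𝟙 X)) ≫ orbitMap ρ π hπ := by
      rw [Category.assoc, hσ', hc, Category.comp_id]
    exact congrArg Subtype.val ((h.bijective_app X.toOver).1 (a₁ := ⟨π.1 ≫ σ, π.2.comp hσP⟩)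
      (a₂ := ⟨geomMap (orbitClass ρ (𝟙 X)), IsPMorphism.of_hom _⟩) (Subtype.ext e))
  refine hom_ext_of_surjective _ (orbitClass_id_surjective ρ) (key.trans ?_)
  exact (Category.comp_id _).symm

/-- Each quotient represents the geometric points of the same functor `X^P/G`, through P-morphisms
in both directions. -/
lemma IsStrongPQuotient.nonempty_iso {X W W' : PSch S} {ρ : PAction G X} {π : X ⟶ W} {π' : X ⟶ W'}
    (h : IsStrongPQuotient ρ π) (h' : IsStrongPQuotient ρ π') : Nonempty (W ≅ W') := by
  obtain ⟨hπ, σ, hσ, h₁, h₂⟩ := h.exists_inverse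
  obtain ⟨hπ', σ', hσ', h₁', h₂'⟩ := h'.exists_inverse
  exact ⟨
    { hom := (extendP (quotMap ρ π' hπ')).app (op W.toOver) ⟨σ, hσ⟩
      inv := (extendP (quotMap ρ π hπ)).app (op W'.toOver) ⟨σ', hσ'⟩
      hom_inv_id := Subtype.ext <| by
        change (σ ≫ orbitMap ρ π' hπ') ≫ σ' ≫ orbitMap ρ π hπ = 𝟙 _
        rw [Category.assoc, reassoc_of% h₂', h₁]
      inv_hom_id := Subtype.ext <| by
        change (σ' ≫ orbitMap ρ π hπ) ≫ σ ≫ orbitMap ρ π' hπ' = 𝟙 _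
        rw [Category.assoc, reassoc_of% h₂, h₁'] }⟩

/-! ### Criteria for geometric quotients and P-isomorphisms -/

lemma IsGeometricQuotient.of_iso {X X' W : PSch S} {ρ : PAction G X} (e : X ≅ X') {π : X' ⟶ W}
    (h : IsGeometricQuotient (e.conjAut.toMonoidHom.comp ρ) π) :
    IsGeometricQuotient ρ (e.hom ≫ π) where
  apply_eq_iff K x y := by
    have h₁ (x) : e.inv.1.app K (e.hom.1.app K x) = x :=
      ConcreteCategory.congr_hom (NatTrans.congr_app (congrArg Subtype.val e.hom_inv_id) K) x
    have h₂ (x) : e.hom.1.app K (e.inv.1.app K x) = x :=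
      ConcreteCategory.congr_hom (NatTrans.congr_app (congrArg Subtype.val e.inv_hom_id) K) x
    refine (h.apply_eq_iff K (e.hom.1.app K x) (e.hom.1.app K y)).trans (exists_congr fun g ↦ ?_)
    change e.hom.1.app K ((ρ g).hom.1.app K (e.inv.1.app K (e.hom.1.app K x))) = _ ↔ _
    rw [h₁]
    exact ⟨fun h ↦ by rw [← h₁ y, ← h, h₁], fun h ↦ by rw [h]⟩
  exists_section := by
    obtain ⟨Z, q, s, hq, hs⟩ := h.exists_section
    refine ⟨Z, q, s ≫ e.inv, hq, ?_⟩
    change ((s ≫ e.inv) ≫ e.hom ≫ π).1 = _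
    rw [Category.assoc, e.inv_hom_id_assoc]
    exact hs

/-- A span `X ⟵ Z ⟶ W` of sur coverings which identifies the equality of geometric points in `W`
with the orbit relation in `X` makes `W` a geometric quotient of `X`. -/
lemma exists_isGeometricQuotient {X W : PSch S} (ρ : PAction G X) {Z : Over S}
    {p : Z ⟶ X.toOver} {q : Z ⟶ W.toOver} (hp : IsSurCovering p) (hq : IsSurCovering q)
    (h : ∀ (K : ACF S) (z z' : Over.mk K.str ⟶ Z), z ≫ q = z' ≫ q ↔
      ∃ g : G, (ρ g).hom.1.app K ⟨z ≫ p⟩ = ⟨z' ≫ p⟩) :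
    ∃ π : X ⟶ W, IsGeometricQuotient ρ π := by
  have h' (K) (x y : (geom (pts Z)).obj K) : (geomMap (ptsMap q)).app K x =
      (geomMap (ptsMap q)).app K y ↔ ∃ g : G, (ρ g).hom.1.app K ((geomMap (ptsMap p)).app K x) =
        (geomMap (ptsMap p)).app K y :=
    (ULift.up_injective.eq_iff (a := x.down ≫ q) (b := y.down ≫ q)).trans (h K x.down y.down)
  obtain ⟨π, hπ⟩ := exists_descent (geomMap (ptsMap p)) hp.surjective_app (geomMap (ptsMap q)) (by
    intro K x y hxy
    refine (h' K x y).mpr ⟨1, ?_⟩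
    rw [hxy, map_one]
    rfl)
  have hπ' (K) (x) : π.app K ((geomMap (ptsMap p)).app K x) = (geomMap (ptsMap q)).app K x :=
    ConcreteCategory.congr_hom (NatTrans.congr_app hπ K) x
  refine ⟨⟨π, Z, p, ptsMap q, hp, hπ⟩, ?_, Z, q, ⟨_, IsPMorphism.of_hom (ptsMap p)⟩, hq, hπ⟩
  intro K x y
  obtain ⟨x, rfl⟩ := hp.surjective_app K x
  obtain ⟨y, rfl⟩ := hp.surjective_app K y
  refine Iff.trans ?_ (h' K x y)
  change π.app K _ = π.app K _ ↔ _
  rw [hπ', hπ']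

/-- A sur covering which is injective on geometric points is a P-isomorphism. -/
lemma IsSurCovering.nonempty_iso {Y X : Over S} {f : Y ⟶ X} (hf : IsSurCovering f)
    (h : ∀ (K : ACF S) (y y' : Over.mk K.str ⟶ Y), y ≫ f = y' ≫ f → y = y') :
    Nonempty ((⟨Y⟩ : PSch S) ≅ ⟨X⟩) := by
  obtain ⟨b, hb⟩ := exists_descent (geomMap (ptsMap f)) hf.surjective_app (𝟙 _) (by
    intro K x y hxy
    exact congrArg ULift.up (h K x.down y.down (ULift.up_injective hxy)))
  have hb' : b ≫ geomMap (ptsMap f) = 𝟙 _ := by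
    refine hom_ext_of_surjective _ hf.surjective_app ?_
    rw [reassoc_of% hb, Category.comp_id]
  exact ⟨
    { hom := ⟨geomMap (ptsMap f), .of_hom _⟩
      inv := ⟨b, Y, f, 𝟙 _, hf, hb⟩
      hom_inv_id := Subtype.ext hb
      inv_hom_id := Subtype.ext hb' }⟩

end PSchemes

namespace PSchemes

/-! ### Separating unordered families of points by finitely many functions -/

section OrbitPolynomial

variable {B R : Type u} [CommRing R] {G : Type v} [Fintype G]

/-- The product of the forms `T - ∑ b ∈ s, β g b • X b` over all `g`. -/
noncomputable def orbitPolynomial (s : Finset B) (β : G → B → R) : MvPolynomial (Option B) R :=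
  ∏ g, (MvPolynomial.X none - ∑ b ∈ s, MvPolynomial.C (β g b) * MvPolynomial.X (some b))

lemma map_orbitPolynomial {R' : Type u} [CommRing R'] (s : Finset B) (β : G → B → R)
    (z : R →+* R') :
    (orbitPolynomial s β).map z = orbitPolynomial s fun g b ↦ z (β g b) := by
  simp [orbitPolynomial]

lemma orbitPolynomial_comp_perm (s : Finset B) (β : G → B → R) (σ : Equiv.Perm G) :
    orbitPolynomial s (fun g ↦ β (σ g)) = orbitPolynomial s β :=
  Equiv.prod_comp σ fun g ↦
    (MvPolynomial.X none - ∑ b ∈ s, MvPolynomial.C (β g b) * MvPolynomial.X (some b))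

/-- Substituting the `j`-th linear form of `γ` for `T` kills the product attached to `γ`, hence also
the one attached to `β`. In a domain some factor vanishes, so two linear forms coincide. -/
lemma exists_eq_of_orbitPolynomial_eq [IsDomain R] {s : Finset B} {β γ : G → B → R}
    (h : orbitPolynomial s β = orbitPolynomial s γ) (j : G) : ∃ g, ∀ b ∈ s, β g b = γ j b := by
  classical
  let ℓ (β : G → B → R) (g : G) : MvPolynomial B R :=
    ∑ b ∈ s, MvPolynomial.C (β g b) * MvPolynomial.X b
  have key (β : G → B → R) : MvPolynomial.aeval (fun o : Option B ↦ o.elim (ℓ γ j) MvPolynomial.X)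
      (orbitPolynomial s β) = ∏ g, (ℓ γ j - ℓ β g) := by
    simp [orbitPolynomial, ℓ, MvPolynomial.algebraMap_eq]
  have h0 : ∏ g, (ℓ γ j - ℓ β g) = 0 := by
    rw [← key, h, key]
    exact Finset.prod_eq_zero (Finset.mem_univ j) (sub_self _)
  obtain ⟨g, -, hg⟩ := Finset.prod_eq_zero_iff.mp h0
  refine ⟨g, fun b hb ↦ ?_⟩
  have hc (β : G → B → R) (g : G) : (ℓ β g).coeff (Finsupp.single b 1) = β g b := by
    simp [ℓ, MvPolynomial.coeff_sum, MvPolynomial.coeff_C_mul, MvPolynomial.coeff_X, hb,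
      Finsupp.single_left_inj]
  rw [← hc β, ← hc γ, ← sub_eq_zero.mp hg]

/-- Finitely many functions on `Spec R` separate the unordered families `(z ∘ β g)_g` of points of
`Spec B` attached to the points `z` of `Spec R`. -/
lemma exists_separating_algHom {k : Type u} [CommRing k] [CommRing B] [Algebra k B] [Algebra k R]
    [Algebra.FiniteType k B] (β : G → B →ₐ[k] R) :
    ∃ (ι : Type u) (_ : Finite ι) (φ : MvPolynomial ι k →ₐ[k] R),
      (∀ (K : Type u) [Field K] [Algebra k K] (z z' : R →ₐ[k] K) (σ : Equiv.Perm G),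
        (∀ g, z.comp (β (σ g)) = z'.comp (β g)) → z.comp φ = z'.comp φ) ∧
      (∀ (K : Type u) [Field K] [Algebra k K] (z z' : R →ₐ[k] K), z.comp φ = z'.comp φ →
        ∀ j, ∃ g, z.comp (β g) = z'.comp (β j)) := by
  obtain ⟨s, hs⟩ := (inferInstance : Algebra.FiniteType k B).out
  let P := orbitPolynomial s fun g ↦ β g
  -- The variables go to the nonzero coefficients of `P`; the remaining coefficients vanish under
  -- both `z` and `z'`, so agreement after `φ` is equality of the specialized polynomials.
  have hφ (K : Type u) [Field K] [Algebra k K] (z z' : R →ₐ[k] K) :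
      z.comp (MvPolynomial.aeval fun m : P.support ↦ P.coeff m.1) =
        z'.comp (MvPolynomial.aeval fun m : P.support ↦ P.coeff m.1) ↔
      orbitPolynomial s (fun g ↦ z.comp (β g)) = orbitPolynomial s (fun g ↦ z'.comp (β g)) := by
    change _ ↔ (orbitPolynomial s fun g b ↦ z.toRingHom (β g b)) =
      orbitPolynomial s fun g b ↦ z'.toRingHom (β g b)
    rw [← map_orbitPolynomial, ← map_orbitPolynomial]
    constructor
    · intro h
      ext m
      rw [MvPolynomial.coeff_map, MvPolynomial.coeff_map]
      by_cases hm : m ∈ P.support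
      · simpa using DFunLike.congr_fun h (MvPolynomial.X ⟨m, hm⟩)
      · have hm : P.coeff m = 0 := MvPolynomial.notMem_support_iff.mp hm
        change z (P.coeff m) = z' (P.coeff m)
        rw [hm, map_zero, map_zero]
    · intro h
      ext m
      simpa [MvPolynomial.coeff_map] using congrArg (MvPolynomial.coeff m.1) h
  refine ⟨P.support, inferInstance, MvPolynomial.aeval fun m ↦ P.coeff m.1, ?_, ?_⟩
  · intro K _ _ z z' σ h
    rw [hφ, ← orbitPolynomial_comp_perm s (fun g ↦ z.comp (β g)) σ]
    simp only [h]
  · intro K _ _ z z' h j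
    obtain ⟨g, hg⟩ := exists_eq_of_orbitPolynomial_eq ((hφ K z z').mp h) j
    exact ⟨g, AlgHom.ext_of_adjoin_eq_top hs hg⟩

/-- The same separation without fixed algebra structures, for use with rings of global functions. -/
lemma exists_separating_ringHom {k B R : Type u} [CommRing k] [CommRing B] [CommRing R]
    (κB : k →+* B) (hB : κB.FiniteType) (κR : k →+* R) (β : G → B →+* R)
    (hβ : ∀ g, (β g).comp κB = κR) :
    ∃ (ι : Type u) (_ : Finite ι) (φ : MvPolynomial ι k →+* R), φ.comp MvPolynomial.C = κR ∧
      ∀ (K : Type u) [Field K] (z z' : R →+* K), z.comp κR = z'.comp κR →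
        (∀ σ : Equiv.Perm G, (∀ g, z.comp (β (σ g)) = z'.comp (β g)) → z.comp φ = z'.comp φ) ∧
        (z.comp φ = z'.comp φ → ∀ j, ∃ g, z.comp (β g) = z'.comp (β j)) := by
  let := κB.toAlgebra
  let := κR.toAlgebra
  have : Algebra.FiniteType k B := hB
  let β' (g : G) : B →ₐ[k] R := { β g with commutes' := RingHom.congr_fun (hβ g) }
  obtain ⟨ι, hι, φ, h₁, h₂⟩ := exists_separating_algHom β'
  refine ⟨ι, hι, φ, φ.comp_algebraMap, fun K _ z z' hz ↦ ?_⟩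
  let := (z.comp κR).toAlgebra
  let y : R →ₐ[k] K := { z with commutes' := fun _ ↦ rfl }
  let y' : R →ₐ[k] K := { z' with commutes' := fun r ↦ (RingHom.congr_fun hz r).symm }
  have hφ : z.comp (φ : MvPolynomial ι k →+* R) = z'.comp φ ↔ y.comp φ = y'.comp φ :=
    ⟨fun h ↦ AlgHom.coe_ringHom_injective h, congrArg AlgHom.toRingHom⟩
  have hg (g j) : z.comp (β g) = z'.comp (β j) ↔ y.comp (β' g) = y'.comp (β' j) :=
    ⟨fun h ↦ AlgHom.coe_ringHom_injective h, congrArg AlgHom.toRingHom⟩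
  simp only [hφ, hg]
  exact ⟨h₁ K y y', h₂ K y y'⟩

end OrbitPolynomial

/-! ### Constructible sets as images of morphisms injective on points -/

section Constructible

variable {R : Type u} [CommRing R]

/-- The points of `Spec R` in `C` with values in fields are those that lift to a given `R`-algebra
of finite type, in which case the lift is unique. -/
def IsModelled (C : Set (PrimeSpectrum R)) : Prop :=
  ∃ (A : Type u) (_ : CommRing A) (_ : Algebra R A), Algebra.FiniteType R A ∧
    ∀ (K : Type u) [Field K] (φ : R →+* K),
      (PrimeSpectrum.comap φ ⊥ ∈ C ↔ ∃ ψ : A →+* K, ψ.comp (algebraMap R A) = φ) ∧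
      ∀ ψ ψ' : A →+* K, ψ.comp (algebraMap R A) = φ → ψ'.comp (algebraMap R A) = φ → ψ = ψ'

lemma comap_bot_mem_zeroLocus {K : Type u} [Field K] (φ : R →+* K) (s : Set R) :
    PrimeSpectrum.comap φ ⊥ ∈ PrimeSpectrum.zeroLocus s ↔ ∀ r ∈ s, φ r = 0 := by
  simp [PrimeSpectrum.mem_zeroLocus, Set.subset_def]

lemma isModelled_univ : IsModelled (Set.univ : Set (PrimeSpectrum R)) :=
  ⟨R, inferInstance, inferInstance, inferInstance, fun K _ φ ↦
    ⟨by simp, fun ψ ψ' h h' ↦ by simpa using h.trans h'.symm⟩⟩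

/-- Localizing the model at `r` keeps exactly the points where `r` is nonzero. -/
lemma IsModelled.diff_zeroLocus_singleton {C : Set (PrimeSpectrum R)} (hC : IsModelled C) (r : R) :
    IsModelled (C \ PrimeSpectrum.zeroLocus {r}) := by
  obtain ⟨A, _, _, hA, h⟩ := hC
  let A' := Localization.Away (algebraMap R A r)
  have : Algebra.FiniteType A A' := IsLocalization.finiteType_of_monoid_fg
    (Submonoid.powers (algebraMap R A r)) A'
  refine ⟨A', inferInstance, inferInstance, Algebra.FiniteType.trans hA this, fun K _ φ ↦ ?_⟩
  have e (ψ : A' →+* K) :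
      ψ.comp (algebraMap R A') = (ψ.comp (algebraMap A A')).comp (algebraMap R A) := by
    rw [RingHom.comp_assoc, ← IsScalarTower.algebraMap_eq]
  refine ⟨⟨?_, ?_⟩, ?_⟩
  · rintro ⟨h₁, h₂⟩
    obtain ⟨ψ, hψ⟩ := (h K φ).1.mp h₁
    have hr : IsUnit (ψ (algebraMap R A r)) := by
      rw [isUnit_iff_ne_zero, ← RingHom.comp_apply, hψ]
      simpa [comap_bot_mem_zeroLocus] using h₂
    exact ⟨IsLocalization.Away.lift _ hr, by rw [e, IsLocalization.Away.lift_comp, hψ]⟩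
  · rintro ⟨ψ, hψ⟩
    refine ⟨(h K φ).1.mpr ⟨_, (e ψ).symm.trans hψ⟩, ?_⟩
    have hu := (IsLocalization.Away.algebraMap_isUnit (S := A') (algebraMap R A r)).map ψ
    rw [← RingHom.comp_apply, ← RingHom.comp_apply, ← e, hψ] at hu
    simpa [comap_bot_mem_zeroLocus] using hu.ne_zero
  · intro ψ ψ' h₁ h₂
    rw [e] at h₁ h₂
    exact IsLocalization.ringHom_ext (Submonoid.powers (algebraMap R A r)) ((h K φ).2 _ _ h₁ h₂)

/-- Dividing the model by `r` keeps exactly the points where `r` vanishes. -/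
lemma IsModelled.inter_zeroLocus_singleton {C : Set (PrimeSpectrum R)} (hC : IsModelled C) (r : R) :
    IsModelled (C ∩ PrimeSpectrum.zeroLocus {r}) := by
  obtain ⟨A, _, _, hA, h⟩ := hC
  let A' := A ⧸ Ideal.span {algebraMap R A r}
  refine ⟨A', inferInstance, inferInstance, Algebra.FiniteType.trans hA inferInstance,
    fun K _ φ ↦ ?_⟩
  have e (ψ : A' →+* K) :
      ψ.comp (algebraMap R A') = (ψ.comp (algebraMap A A')).comp (algebraMap R A) := by
    rw [RingHom.comp_assoc, ← IsScalarTower.algebraMap_eq]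
  refine ⟨⟨?_, ?_⟩, ?_⟩
  · rintro ⟨h₁, h₂⟩
    obtain ⟨ψ, hψ⟩ := (h K φ).1.mp h₁
    have hr : ψ (algebraMap R A r) = 0 := by
      rw [← RingHom.comp_apply, hψ]
      simpa [comap_bot_mem_zeroLocus] using h₂
    refine ⟨Ideal.Quotient.lift _ ψ fun a ha ↦ ?_, ?_⟩
    · obtain ⟨b, rfl⟩ := Ideal.mem_span_singleton'.mp ha
      rw [map_mul, hr, mul_zero]
    · rw [e]
      refine Eq.trans ?_ hψ
      congr 1
  · rintro ⟨ψ, hψ⟩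
    refine ⟨(h K φ).1.mpr ⟨_, (e ψ).symm.trans hψ⟩, ?_⟩
    have : ψ (algebraMap A A' (algebraMap R A r)) = 0 := by
      have : algebraMap A A' (algebraMap R A r) = 0 :=
        Ideal.Quotient.eq_zero_iff_mem.mpr (Ideal.mem_span_singleton_self _)
      rw [this, map_zero]
    rw [← RingHom.comp_apply, ← RingHom.comp_apply, ← e, hψ] at this
    simpa [comap_bot_mem_zeroLocus] using this
  · intro ψ ψ' h₁ h₂
    rw [e] at h₁ h₂
    exact Ideal.Quotient.ringHom_ext ((h K φ).2 _ _ h₁ h₂)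

/-- The complementary idempotents `(1, 0)` and `(0, 1)` map to elements of a field with product `0`
and sum `1`, so one of them dies. -/
lemma ringHom_prod_field {A B K : Type u} [CommRing A] [CommRing B] [Field K] (ψ : A × B →+* K) :
    (∃ α : A →+* K, ψ = α.comp (RingHom.fst A B)) ∨
      ∃ β : B →+* K, ψ = β.comp (RingHom.snd A B) := by
  have h1 : ψ (1, 0) + ψ (0, 1) = 1 := by
    rw [← map_add, Prod.mk_add_mk, add_zero, zero_add]
    exact map_one ψ
  have h0 : ψ (1, 0) * ψ (0, 1) = 0 := by
    rw [← map_mul, Prod.mk_mul_mk, mul_zero, zero_mul]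
    exact map_zero ψ
  have hd (x : A × B) : ψ x = ψ (x.1, 0) + ψ (0, x.2) := by rw [← map_add]; simp
  rcases mul_eq_zero.mp h0 with h | h
  · right
    rw [h, zero_add] at h1
    refine ⟨⟨⟨⟨fun b ↦ ψ (0, b), h1⟩, fun x y ↦ ?_⟩, map_zero ψ, fun x y ↦ ?_⟩, ?_⟩
    · change ψ _ = ψ _ * ψ _
      rw [← map_mul]; simp
    · change ψ _ = ψ _ + ψ _
      rw [← map_add]; simp
    · ext x
      have : ψ (x.1, 0) = 0 := by
        rw [show (x.1, (0 : B)) = (1, 0) * x by ext <;> simp, map_mul, h, zero_mul]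
      rw [hd, this, zero_add]
      rfl
  · left
    rw [h, add_zero] at h1
    refine ⟨⟨⟨⟨fun b ↦ ψ (b, 0), h1⟩, fun x y ↦ ?_⟩, map_zero ψ, fun x y ↦ ?_⟩, ?_⟩
    · change ψ _ = ψ _ * ψ _
      rw [← map_mul]; simp
    · change ψ _ = ψ _ + ψ _
      rw [← map_add]; simp
    · ext x
      have : ψ (0, x.2) = 0 := by
        rw [show ((0 : A), x.2) = (0, 1) * x by ext <;> simp, map_mul, h, zero_mul]
      rw [hd, this, add_zero]
      rfl

/-- The product ring models the union; disjointness is needed for lifts to remain unique. -/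
lemma IsModelled.union {C D : Set (PrimeSpectrum R)} (hC : IsModelled C) (hD : IsModelled D)
    (hCD : Disjoint C D) : IsModelled (C ∪ D) := by
  obtain ⟨A, _, _, hA, h⟩ := hC
  obtain ⟨B, _, _, hB, h'⟩ := hD
  refine ⟨A × B, inferInstance, inferInstance, inferInstance, fun K _ φ ↦ ⟨⟨?_, ?_⟩, ?_⟩⟩
  · rintro (hφ | hφ)
    · obtain ⟨ψ, hψ⟩ := (h K φ).1.mp hφ
      exact ⟨ψ.comp (RingHom.fst A B), hψ⟩
    · obtain ⟨ψ, hψ⟩ := (h' K φ).1.mp hφ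
      exact ⟨ψ.comp (RingHom.snd A B), hψ⟩
  · rintro ⟨ψ, hψ⟩
    obtain ⟨α, rfl⟩ | ⟨α, rfl⟩ := ringHom_prod_field ψ
    · exact .inl ((h K φ).1.mpr ⟨α, hψ⟩)
    · exact .inr ((h' K φ).1.mpr ⟨α, hψ⟩)
  · intro ψ ψ' h₁ h₂
    obtain ⟨α, rfl⟩ | ⟨α, rfl⟩ := ringHom_prod_field ψ <;>
    obtain ⟨β, rfl⟩ | ⟨β, rfl⟩ := ringHom_prod_field ψ'
    · rw [(h K φ).2 α β h₁ h₂]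
    · exact (Set.disjoint_left.mp hCD ((h K φ).1.mpr ⟨α, h₁⟩) ((h' K φ).1.mpr ⟨β, h₂⟩)).elim
    · exact (Set.disjoint_left.mp hCD ((h K φ).1.mpr ⟨β, h₂⟩) ((h' K φ).1.mpr ⟨α, h₁⟩)).elim
    · rw [(h' K φ).2 α β h₁ h₂]

lemma isModelled_empty : IsModelled (∅ : Set (PrimeSpectrum R)) := by
  simpa using (isModelled_univ (R := R)).diff_zeroLocus_singleton 0

lemma IsModelled.inter_zeroLocus {C : Set (PrimeSpectrum R)} (hC : IsModelled C) (t : Finset R) :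
    IsModelled (C ∩ PrimeSpectrum.zeroLocus t) := by
  classical
  induction t using Finset.induction_on generalizing C with
  | empty => simpa using hC
  | insert a t _ ih =>
    convert ih (hC.inter_zeroLocus_singleton a) using 1
    rw [Finset.coe_insert, ← Set.union_singleton, Set.union_comm, PrimeSpectrum.zeroLocus_union,
      Set.inter_assoc]

lemma IsModelled.diff_zeroLocus {C : Set (PrimeSpectrum R)} (hC : IsModelled C) (t : Finset R) :
    IsModelled (C \ PrimeSpectrum.zeroLocus t) := by
  classical
  induction t using Finset.induction_on generalizing C with
  | empty => simpa using isModelled_empty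
  | insert a t _ ih =>
    -- Disjoint splitting: either `a` is nonzero, or `a` vanishes and some element of `t` does not.
    convert (hC.diff_zeroLocus_singleton a).union (ih (hC.inter_zeroLocus_singleton a)) ?_ using 1
    · rw [Finset.coe_insert, ← Set.union_singleton, Set.union_comm, PrimeSpectrum.zeroLocus_union]
      grind
    · rw [Set.disjoint_left]
      grind

lemma isModelled_of_isConstructible {C : Set (PrimeSpectrum R)} (hC : Topology.IsConstructible C) :
    IsModelled C := by
  classical
  obtain ⟨D, rfl⟩ := PrimeSpectrum.exists_constructibleSetData_iff.mpr hC
  clear hC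
  induction D using Finset.induction_on with
  | empty => simpa [PrimeSpectrum.ConstructibleSetData.toSet] using isModelled_empty
  | insert b D _ ih =>
    let t : Finset R := Finset.univ.image b.g
    have hb : b.toSet = (Set.univ ∩ PrimeSpectrum.zeroLocus t) \ PrimeSpectrum.zeroLocus {b.f} := by
      simp [PrimeSpectrum.BasicConstructibleSetData.toSet, t]
    have h₁ := (isModelled_univ.inter_zeroLocus t).diff_zeroLocus_singleton b.f
    -- The rest of `D` outside `b = V(t) \ V(f)`, split disjointly into its part in `V(f)` and its
    -- part outside both `V(f)` and `V(t)`.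
    have h₂ := (ih.inter_zeroLocus_singleton b.f).union
      ((ih.diff_zeroLocus_singleton b.f).diff_zeroLocus t) (by rw [Set.disjoint_left]; grind)
    convert h₁.union h₂ ?_ using 1
    · rw [PrimeSpectrum.ConstructibleSetData.toSet, Finset.set_biUnion_insert, hb,
        ← PrimeSpectrum.ConstructibleSetData.toSet]
      grind
    · rw [Set.disjoint_left]
      grind

end Constructible

end PSchemes

namespace PSchemes

open scoped Topology

/-! ### Quasi-compact refinements of sur coverings -/

lemma isOpen_constructibleTopology_of_isConstructible {X : Type*} [TopologicalSpace X]
    [CompactSpace X] {s : Set X} (hs : Topology.IsConstructible s) :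
    IsOpen[constructibleTopology X] s ∧ IsOpen[constructibleTopology X] sᶜ := by
  induction hs using Topology.IsConstructible.empty_union_induction with
  | open_retrocompact U hU hU' =>
    have hc : IsCompact U := hU'.isCompact
    exact ⟨hc.isOpen_constructibleTopology_of_isOpen hU,
      IsCompact.isOpen_constructibleTopology_of_isClosed (by rwa [compl_compl]) hU.isClosed_compl⟩
  | union s hs t ht h h' =>
    rw [Set.compl_union]
    exact ⟨@IsOpen.union _ _ _ (constructibleTopology X) h.1 h'.1,
      @IsOpen.inter _ (constructibleTopology X) _ _ h.2 h'.2⟩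
  | compl s hs h => exact ⟨h.2, by rw [compl_compl]; exact h.1⟩

/-- Constructible sets are open in the constructible topology, which is compact on such a space. -/
lemma exists_finset_iUnion_eq_univ_of_isConstructible {X : Type*} [TopologicalSpace X]
    [CompactSpace X] [QuasiSober X] [PrespectralSpace X] [QuasiSeparatedSpace X] {α : Type*}
    (s : α → Set X) (hs : ∀ a, Topology.IsConstructible (s a)) (h : ⋃ a, s a = Set.univ) :
    ∃ t : Finset α, ⋃ a ∈ t, s a = Set.univ := by
  obtain ⟨t, ht⟩ := (isCompact_univ (X := WithConstructibleTopology X)).elim_finite_subcover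
    (fun a ↦ WithTopology.ofTopology ⁻¹' (s a))
    (fun a ↦ by
      rw [WithConstructibleTopology.isOpen_iff]
      exact (isOpen_constructibleTopology_of_isConstructible (hs a)).1)
    (fun x _ ↦ by
      obtain ⟨a, ha⟩ := Set.mem_iUnion.mp (h.symm ▸ Set.mem_univ (WithTopology.ofTopology x))
      exact Set.mem_iUnion.mpr ⟨a, ha⟩)
  refine ⟨t, Set.eq_univ_of_forall fun x ↦ ?_⟩
  simpa using ht (Set.mem_univ (WithTopology.toTopology _ x))

/-- A surjective morphism locally of finite presentation to an affine scheme is still surjective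
on some quasi-compact open. -/
lemma exists_isCompact_image_eq_univ {Z X : Scheme.{u}} (f : Z ⟶ X) [IsAffine X]
    [LocallyOfFinitePresentation f] [Surjective f] :
    ∃ O : Z.Opens, IsCompact (O : Set Z) ∧ f '' O = Set.univ := by
  have hs (U : Z.affineOpens) : Topology.IsConstructible (f '' U.1) := by
    have : IsAffine U.1 := U.2
    convert (U.1.ι ≫ f).isConstructible_image .univ using 1
    rw [Set.image_univ]
    ext x
    exact ⟨fun ⟨z, hz, h⟩ ↦ ⟨⟨z, hz⟩, h⟩, fun ⟨z, h⟩ ↦ ⟨z.1, z.2, h⟩⟩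
  obtain ⟨t, ht⟩ := exists_finset_iUnion_eq_univ_of_isConstructible _ hs (by
    refine Set.eq_univ_of_forall fun x ↦ ?_
    obtain ⟨z, rfl⟩ := f.surjective x
    obtain ⟨U, hU, hz, -⟩ := exists_isAffineOpen_mem_and_subset (TopologicalSpace.Opens.mem_top z)
    exact Set.mem_iUnion.mpr ⟨⟨U, hU⟩, z, hz, rfl⟩)
  refine ⟨⨆ U ∈ t, U.1, ?_, ?_⟩
  · simpa using t.isCompact_biUnion fun U _ ↦ U.2.isCompact
  · rw [← ht]
    simp [Set.image_iUnion]

/-- A sur covering of a disjoint union of affine schemes has a quasi-compact refinement. -/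
lemma exists_opens_quasiCompact {Z X : Scheme.{u}} (f : Z ⟶ X)
    [LocallyOfFinitePresentation f] [Surjective f] {ι : Type*} (V : ι → X.Opens)
    (hV : ∀ i, IsAffineOpen (V i)) (hd : Pairwise (Function.onFun Disjoint V)) (hc : ⨆ i, V i = ⊤) :
    ∃ O : Z.Opens, Surjective (O.ι ≫ f) ∧ QuasiCompact (O.ι ≫ f) := by
  have h (i : ι) : ∃ O : Z.Opens, IsCompact (O : Set Z) ∧ f '' O = V i := by
    have : IsAffine (V i) := hV i
    have : Surjective (f ∣_ V i) := IsZariskiLocalAtTarget.restrict ‹_› _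
    obtain ⟨O, hO, hO'⟩ := exists_isCompact_image_eq_univ (f ∣_ V i)
    refine ⟨(f ⁻¹ᵁ V i).ι ''ᵁ O, hO.image (f ⁻¹ᵁ V i).ι.continuous, ?_⟩
    ext x
    constructor
    · rintro ⟨_, ⟨y, -, rfl⟩, rfl⟩
      exact y.2
    · intro hx
      obtain ⟨y, hy, hyx⟩ : (⟨x, hx⟩ : V i) ∈ (f ∣_ V i) '' O := hO' ▸ Set.mem_univ _
      refine ⟨_, ⟨y, hy, rfl⟩, ?_⟩
      exact (morphismRestrict_base_coe f (V i) y).symm.trans (congrArg Subtype.val hyx)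
  choose O hO hO' using h
  have hOV (i : ι) : (O i : Set Z) ⊆ f ⁻¹' V i := by rw [← hO']; exact Set.subset_preimage_image _ _
  refine ⟨⨆ i, O i, ⟨fun x ↦ ?_⟩, ?_⟩
  · obtain ⟨i, hi⟩ := TopologicalSpace.Opens.mem_iSup.mp
      (hc.symm ▸ TopologicalSpace.Opens.mem_top x : x ∈ ⨆ i, V i)
    obtain ⟨z, hz, rfl⟩ : x ∈ f '' O i := by rwa [hO']
    exact ⟨⟨z, TopologicalSpace.Opens.mem_iSup.mpr ⟨i, hz⟩⟩, rfl⟩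
  · have := @HasAffineProperty.instIsZariskiLocalAtTarget @QuasiCompact _
      instHasAffinePropertyQuasiCompactCompactSpaceCarrierCarrierCommRingCat
    refine IsZariskiLocalAtTarget.of_iSup_eq_top (P := @QuasiCompact) V hc fun i ↦ ?_
    have : IsAffine (V i) := hV i
    rw [quasiCompact_iff_compactSpace]
    refine isCompact_iff_compactSpace.mp ?_
    rw [(⨆ i, O i).ι.isOpenEmbedding.isCompact_iff]
    -- As the `V j` are disjoint and `O j` lies over `V j`, only `O i` contributes over `V i`.
    convert hO i using 1
    ext z
    constructor
    · rintro ⟨z, hz, rfl⟩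
      obtain ⟨j, hj⟩ := TopologicalSpace.Opens.mem_iSup.mp z.2
      obtain rfl | hij := eq_or_ne i j
      · exact hj
      · exact (Set.disjoint_left.mp (TopologicalSpace.Opens.coe_disjoint.mpr (hd hij)) hz
          (hOV j hj)).elim
    · intro hz
      exact ⟨⟨z, TopologicalSpace.Opens.mem_iSup.mpr ⟨i, hz⟩⟩, hOV i hz, rfl⟩

end PSchemes

namespace PSchemes

/-! ### Quotients on a quasi-compact piece -/

lemma over_hom_eq_iff {S : Scheme.{u}} {X Y : Over S} {f g : X ⟶ Y} :
    f = g ↔ f.left = g.left :=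
  ⟨fun h ↦ h ▸ rfl, Over.OverMorphism.ext⟩

lemma comap_algebraMap_residueField_bot {R : Type u} [CommRing R] (p : PrimeSpectrum R) :
    PrimeSpectrum.comap (algebraMap R p.asIdeal.ResidueField) ⊥ = p := by
  ext r
  simp

/-- Lifting criteria on field-valued points are tested on residue fields. -/
lemma range_comap_eq_of_forall_field {R A : Type u} [CommRing R] [CommRing A] [Algebra R A]
    {C : Set (PrimeSpectrum R)} (h : ∀ (K : Type u) [Field K] (φ : R →+* K),
      PrimeSpectrum.comap φ ⊥ ∈ C ↔ ∃ ψ : A →+* K, ψ.comp (algebraMap R A) = φ) :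
    Set.range (PrimeSpectrum.comap (algebraMap R A)) = C := by
  ext p
  constructor
  · rintro ⟨a, rfl⟩
    have := (h a.asIdeal.ResidueField _).mpr ⟨algebraMap A _, rfl⟩
    rwa [PrimeSpectrum.comap_comp_apply, comap_algebraMap_residueField_bot] at this
  · intro hp
    obtain ⟨ψ, hψ⟩ := (h p.asIdeal.ResidueField (algebraMap _ _)).mp
      (by rwa [comap_algebraMap_residueField_bot])
    exact ⟨PrimeSpectrum.comap ψ ⊥, by
      rw [← PrimeSpectrum.comap_comp_apply, hψ, comap_algebraMap_residueField_bot]⟩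

/-- Evaluation of global functions at a point with values in a field. -/
noncomputable def evalPt {K : Type u} [Field K] {X : Scheme.{u}} (z : Spec (.of K) ⟶ X) :
    Γ(X, ⊤) →+* K :=
  (z.appTop ≫ (Scheme.ΓSpecIso (.of K)).hom).hom

section

variable {K : Type u} [Field K] {X Y : Scheme.{u}}

lemma evalPt_comp (z : Spec (.of K) ⟶ X) (f : X ⟶ Y) :
    evalPt (z ≫ f) = (evalPt z).comp f.appTop.hom := by
  rw [evalPt, Scheme.Hom.comp_appTop, Category.assoc]
  rfl

lemma evalPt_injective [IsAffine X] : Function.Injective (evalPt : (Spec (.of K) ⟶ X) → _) := by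
  intro z z' h
  apply ext_of_isAffine
  rw [← cancel_mono (Scheme.ΓSpecIso (.of K)).hom]
  exact CommRingCat.hom_ext h

lemma comp_toSpecΓ_eq (z : Spec (.of K) ⟶ X) :
    z ≫ X.toSpecΓ = Spec.map (CommRingCat.ofHom (evalPt z)) := by
  rw [Scheme.toSpecΓ_naturality, evalPt, CommRingCat.ofHom_hom, Spec.map_comp]
  congr 1
  simp

end

/-- The structure map of the ring of global functions of a scheme over `Spec k`. -/
noncomputable def globalMap {k : Type u} [Field k] (X : Over (Spec (.of k))) :
    k →+* Γ(X.left, ⊤) :=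
  ((Scheme.ΓSpecIso (.of k)).inv ≫ X.hom.appTop).hom

lemma toSpecΓ_globalMap {k : Type u} [Field k] (X : Over (Spec (.of k))) :
    X.left.toSpecΓ ≫ Spec.map (CommRingCat.ofHom (globalMap X)) = X.hom := by
  rw [globalMap, CommRingCat.ofHom_hom, Spec.map_comp, ← Scheme.toSpecΓ_naturality_assoc]
  simp

lemma appTop_comp_globalMap {k : Type u} [Field k] {X Y : Over (Spec (.of k))} (f : X ⟶ Y) :
    f.left.appTop.hom.comp (globalMap Y) = globalMap X := by
  change ((Scheme.ΓSpecIso (.of k)).inv ≫ Y.hom.appTop ≫ f.left.appTop).hom = _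
  rw [← Scheme.Hom.comp_appTop, Over.w, globalMap]

lemma finiteType_globalMap {k : Type u} [Field k] (X : Over (Spec (.of k))) [IsAffine X.left]
    [LocallyOfFiniteType X.hom] : (globalMap X).FiniteType := by
  have h : X.hom.appTop.hom.FiniteType :=
    @HasRingHomProperty.appTop @LocallyOfFiniteType _
      instHasRingHomPropertyLocallyOfFiniteTypeFiniteType _ _ X.hom ‹_› ‹_› inferInstance
  refine h.comp (.of_surjective _ ?_)
  exact (ConcreteCategory.bijective_of_isIso (Scheme.ΓSpecIso (.of k)).inv).2

lemma evalPt_comp_globalMap {k : Type u} [Field k] {X : Over (Spec (.of k))}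
    {K : ACF (Spec (.of k))} (z : Over.mk K.str ⟶ X) :
    (evalPt (K := K.carrier) z.left).comp (globalMap X) =
      (evalPt K.str).comp (Scheme.ΓSpecIso (.of k)).inv.hom := by
  have : evalPt (K := K.carrier) (z.left ≫ X.hom) = evalPt K.str := congrArg _ (Over.w z)
  rw [← this, evalPt_comp]
  simp [globalMap, RingHom.comp_assoc]

lemma locallyOfFiniteType_SpecMap {R A : Type u} [CommRing R] [CommRing A] {f : R →+* A}
    (hf : f.FiniteType) : LocallyOfFiniteType (Spec.map (CommRingCat.ofHom f)) :=
  HasRingHomProperty.Spec_iff.mpr hf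

/-- The unordered families `(b g z)_g` attached to the points `z` of a quasi-compact scheme `T`
are parametrized, after a surjective base change `T' ⟶ T`, by an affine scheme of finite type. -/
lemma exists_affine_orbitSpace {k : Type u} [Field k] {G : Type v} [Finite G]
    {T U : Over (Spec (.of k))} [CompactSpace T.left] [LocallyOfFiniteType T.hom] [IsAffine U.left]
    [LocallyOfFiniteType U.hom] (b : G → (T ⟶ U)) :
    ∃ (W T' : Over (Spec (.of k))) (r : T' ⟶ T) (q : T' ⟶ W),
      IsAffine W.left ∧ LocallyOfFiniteType W.hom ∧ LocallyOfFiniteType T'.hom ∧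
      Surjective r.left ∧ Surjective q.left ∧
      ∀ (K : ACF (Spec (.of k))) (z z' : Over.mk K.str ⟶ T'),
        (∀ σ : Equiv.Perm G, (∀ g, z ≫ r ≫ b (σ g) = z' ≫ r ≫ b g) → z ≫ q = z' ≫ q) ∧
        (z ≫ q = z' ≫ q → ∀ j, ∃ g, z ≫ r ≫ b g = z' ≫ r ≫ b j) := by
  have := Fintype.ofFinite G
  obtain ⟨ι, _, φ, hφ, hsep⟩ := exists_separating_ringHom (globalMap U) (finiteType_globalMap U)
    (globalMap T) (fun g ↦ (b g).left.appTop.hom) (fun g ↦ appTop_comp_globalMap (b g))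
  let c : Spec (.of (MvPolynomial ι k)) ⟶ Spec (.of k) :=
    Spec.map (CommRingCat.ofHom MvPolynomial.C)
  let Φ : T.left ⟶ Spec (.of (MvPolynomial ι k)) := T.left.toSpecΓ ≫ Spec.map (CommRingCat.ofHom φ)
  have hΦc : Φ ≫ c = T.hom := by
    simp only [Φ, c, Category.assoc]
    rw [← Spec.map_comp, ← CommRingCat.ofHom_comp, hφ, toSpecΓ_globalMap]
  have hc : LocallyOfFiniteType c := locallyOfFiniteType_SpecMap
    (RingHom.finiteType_algebraMap.mpr (inferInstanceAs (Algebra.FiniteType k (MvPolynomial ι k))))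
  have : IsNoetherianRing (CommRingCat.of (MvPolynomial ι k)) :=
    inferInstanceAs (IsNoetherianRing (MvPolynomial ι k))
  -- Affine space over `k` is Noetherian, so finite type suffices for Chevalley's theorem below.
  have hΦ : LocallyOfFiniteType Φ := by
    have : LocallyOfFiniteType (Φ ≫ c) := hΦc ▸ ‹_›
    exact locallyOfFiniteType_of_comp Φ c
  have hC : Topology.IsConstructible (Set.range Φ) := by
    rw [← Set.image_univ]
    exact Φ.isConstructible_image .univ
  obtain ⟨A, _, _, hA, hAC⟩ := isModelled_of_isConstructible (R := MvPolynomial ι k) hC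
  let m : Spec (.of A) ⟶ Spec (.of (MvPolynomial ι k)) :=
    Spec.map (CommRingCat.ofHom (algebraMap (MvPolynomial ι k) A))
  have hm : LocallyOfFiniteType m := locallyOfFiniteType_SpecMap
    ((RingHom.finiteType_algebraMap).mpr hA)
  have hrange : Set.range m = Set.range Φ :=
    range_comap_eq_of_forall_field fun K _ φ ↦ (hAC K φ).1
  let r := pullback.fst Φ m
  let q := pullback.snd Φ m
  have hrq : r ≫ T.hom = q ≫ m ≫ c := by
    rw [← hΦc]
    exact pullback.condition_assoc _
  have hpt (K : ACF (Spec (.of k))) (t t' : Over.mk K.str ⟶ T) : t.left ≫ Φ = t'.left ≫ Φ ↔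
      (evalPt (K := K.carrier) t.left).comp φ = (evalPt (K := K.carrier) t'.left).comp φ := by
    have e (t : Over.mk K.str ⟶ T) : t.left ≫ Φ =
        Spec.map (CommRingCat.ofHom ((evalPt (K := K.carrier) t.left).comp φ)) := by
      rw [CommRingCat.ofHom_comp, Spec.map_comp, ← comp_toSpecΓ_eq]
      exact (Category.assoc _ _ _).symm
    rw [e, e, Spec.map_injective.eq_iff]
    exact ⟨fun h ↦ congrArg CommRingCat.Hom.hom h, fun h ↦ congrArg CommRingCat.ofHom h⟩
  refine ⟨Over.mk (m ≫ c), Over.mk (r ≫ T.hom), Over.homMk r, Over.homMk q hrq.symm,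
    ?_, ?_, ?_, ?_, ?_, ?_⟩
  · exact inferInstanceAs (IsAffine (Spec _))
  · exact inferInstanceAs (LocallyOfFiniteType (m ≫ c))
  · exact inferInstanceAs (LocallyOfFiniteType (r ≫ T.hom))
  · refine ⟨fun t ↦ ?_⟩
    obtain ⟨w, hw⟩ : Φ t ∈ Set.range m := hrange ▸ ⟨t, rfl⟩
    obtain ⟨x, hx, -⟩ := Scheme.Pullback.exists_preimage_pullback t w hw.symm
    exact ⟨x, hx⟩
  · refine ⟨fun w ↦ ?_⟩
    obtain ⟨t, ht⟩ : m w ∈ Set.range Φ := hrange ▸ ⟨w, rfl⟩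
    obtain ⟨x, -, hx⟩ := Scheme.Pullback.exists_preimage_pullback t w ht
    exact ⟨x, hx⟩
  · intro K z z'
    have hw : z.left ≫ q = z'.left ≫ q ↔ (z.left ≫ r) ≫ Φ = (z'.left ≫ r) ≫ Φ := by
      have e (z : Over.mk K.str ⟶ Over.mk (r ≫ T.hom)) : (z.left ≫ r) ≫ Φ = (z.left ≫ q) ≫ m := by
        rw [Category.assoc, Category.assoc]
        exact congrArg (z.left ≫ ·) pullback.condition
      rw [e, e]
      -- Lifts of field-valued points through `m` are unique, so `q` identifies the same points as
      -- `Φ`.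
      refine ⟨fun h ↦ by rw [h], fun h ↦ ?_⟩
      obtain ⟨ψ, hψ⟩ := Spec.map_surjective (R := .of A) (S := .of K.carrier) (z.left ≫ q)
      obtain ⟨ψ', hψ'⟩ := Spec.map_surjective (R := .of A) (S := .of K.carrier) (z'.left ≫ q)
      rw [← hψ, ← hψ', ← Spec.map_comp, ← Spec.map_comp, Spec.map_injective.eq_iff] at h
      have h := congrArg CommRingCat.Hom.hom h
      have : ψ = ψ' := CommRingCat.hom_ext ((hAC K.carrier _).2 ψ.hom ψ'.hom h rfl)
      rw [← hψ, ← hψ', this]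
    let r' : Over.mk (r ≫ T.hom) ⟶ T := Over.homMk r
    let q' : Over.mk (r ≫ T.hom) ⟶ Over.mk (m ≫ c) := Over.homMk q hrq.symm
    have hq : z ≫ q' = z' ≫ q' ↔
        (evalPt (K := K.carrier) (z ≫ r').left).comp φ =
          (evalPt (K := K.carrier) (z' ≫ r').left).comp φ := by
      rw [← hpt]
      exact over_hom_eq_iff.trans hw
    have hb (g j) : z ≫ r' ≫ b g = z' ≫ r' ≫ b j ↔
        (evalPt (K := K.carrier) (z ≫ r').left).comp (b g).left.appTop.hom =
          (evalPt (K := K.carrier) (z' ≫ r').left).comp (b j).left.appTop.hom := by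
      rw [← evalPt_comp, ← evalPt_comp, evalPt_injective.eq_iff, over_hom_eq_iff]
      rfl
    have := hsep K.carrier (evalPt (K := K.carrier) (z ≫ r').left)
      (evalPt (K := K.carrier) (z' ≫ r').left)
      ((evalPt_comp_globalMap (z ≫ r')).trans (evalPt_comp_globalMap (z' ≫ r')).symm)
    simp only [← hq, ← hb] at this
    exact this

end PSchemes

namespace PSchemes

/-! ### Disjoint unions -/

section DisjUnion

variable {S : Scheme.{u}} {ι : Type u} (V : ι → Over S)

/-- The inclusion of a member into a disjoint union. -/
noncomputable def disjUnionι (i : ι) : V i ⟶ (disjUnion V).toOver :=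
  Over.homMk (Sigma.ι (fun i ↦ (V i).left) i) (by simp [disjUnion])

variable {V}

/-- The morphism out of a disjoint union given by its restrictions to the members. -/
noncomputable def disjUnionDesc {Y : Over S} (f : ∀ i, V i ⟶ Y) : (disjUnion V).toOver ⟶ Y :=
  Over.homMk (Sigma.desc fun i ↦ (f i).left) (Sigma.hom_ext _ _ (by simp [disjUnion]))

@[simp]
lemma disjUnionι_desc {Y : Over S} (f : ∀ i, V i ⟶ Y) (i : ι) :
    disjUnionι V i ≫ disjUnionDesc f = f i :=
  Over.OverMorphism.ext (Sigma.ι_desc _ _)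

instance (i : ι) : IsOpenImmersion (disjUnionι V i).left :=
  inferInstanceAs (IsOpenImmersion (Sigma.ι (fun i ↦ (V i).left) i))

lemma exists_disjUnionι_eq (x : (disjUnion V).toOver.left) :
    ∃ i y, (disjUnionι V i).left y = x :=
  (sigmaOpenCover fun i ↦ (V i).left).exists_eq x

lemma eq_of_disjUnionι_eq {i j : ι} {x : (V i).left} {y : (V j).left}
    (h : (disjUnionι V i).left x = (disjUnionι V j).left y) : i = j :=
  congrArg Sigma.fst ((sigmaι_eq_iff (fun i ↦ (V i).left) i j x y).mp h)

/-- A geometric point of a disjoint union lies on one of its members. -/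
lemma exists_comp_disjUnionι_eq {K : ACF S} (z : Over.mk K.str ⟶ (disjUnion V).toOver) :
    ∃ (i : ι) (y : Over.mk K.str ⟶ V i), y ≫ disjUnionι V i = z := by
  obtain ⟨i, x, hx⟩ := exists_disjUnionι_eq (z.left (IsLocalRing.closedPoint K.carrier))
  have hr : Set.range z.left ⊆ Set.range (disjUnionι V i).left := by
    rintro _ ⟨y, rfl⟩
    exact ⟨x, hx.trans (congrArg z.left (Subsingleton.elim (α := PrimeSpectrum K.carrier) _ _))⟩
  have h := IsOpenImmersion.lift_fac (disjUnionι V i).left z.left hr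
  refine ⟨i, Over.homMk (U := Over.mk K.str)
    (IsOpenImmersion.lift (disjUnionι V i).left z.left hr) ?_,
    Over.OverMorphism.ext h⟩
  rw [← Over.w (disjUnionι V i), reassoc_of% h, Over.w z]

lemma comp_disjUnionι_injective {K : ACF S} {i : ι} {y y' : Over.mk K.str ⟶ V i}
    (h : y ≫ disjUnionι V i = y' ≫ disjUnionι V i) : y = y' := by
  apply Over.OverMorphism.ext
  rw [← cancel_mono (disjUnionι V i).left]
  exact over_hom_eq_iff.mp h

lemma eq_of_comp_disjUnionι_eq {K : ACF S} {i j : ι} {y : Over.mk K.str ⟶ V i}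
    {y' : Over.mk K.str ⟶ V j} (h : y ≫ disjUnionι V i = y' ≫ disjUnionι V j) : i = j := by
  have h := congrArg (fun f ↦ f (IsLocalRing.closedPoint K.carrier)) (over_hom_eq_iff.mp h)
  exact eq_of_disjUnionι_eq h

lemma locallyOfFiniteType_disjUnion (hV : ∀ i, LocallyOfFiniteType (V i).hom) :
    LocallyOfFiniteType (disjUnion V).toOver.hom :=
  @IsZariskiLocalAtSource.sigmaDesc @LocallyOfFiniteType
    (@HasRingHomProperty.instIsZariskiLocalAtSource _ _
      instHasRingHomPropertyLocallyOfFiniteTypeFiniteType) _ _ _ _ _ hV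

lemma compactSpace_disjUnion [Finite ι] (hV : ∀ i, CompactSpace (V i).left) :
    CompactSpace (disjUnion V).toOver.left :=
  (sigmaMk fun i ↦ (V i).left).compactSpace

lemma surjective_disjUnionDesc {Y : Over S} {f : ∀ i, V i ⟶ Y}
    (hf : ∀ y, ∃ i x, (f i).left x = y) : Surjective (disjUnionDesc f).left := by
  refine ⟨fun y ↦ ?_⟩
  obtain ⟨i, x, rfl⟩ := hf y
  refine ⟨(disjUnionι V i).left x, ?_⟩
  rw [← Scheme.Hom.comp_apply, ← Over.comp_left, disjUnionι_desc]

end DisjUnion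

/-! ### Building sur coverings -/

lemma isSurCovering_of_locallyOfFiniteType {k : Type u} [Field k] {Y X : Over (Spec (.of k))}
    (f : Y ⟶ X) (hY : LocallyOfFiniteType Y.hom) (hX : LocallyOfFiniteType X.hom)
    (hf : Surjective f.left) : IsSurCovering f := by
  have : IsNoetherianRing (CommRingCat.of k) := inferInstanceAs (IsNoetherianRing k)
  have : IsLocallyNoetherian X.left := LocallyOfFiniteType.isLocallyNoetherian X.hom
  have : LocallyOfFiniteType (f.left ≫ X.hom) := by rwa [Over.w]
  have := locallyOfFiniteType_of_comp f.left X.hom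
  exact ⟨inferInstance, hf⟩

/-- Finitely many P-morphisms are induced by morphisms on a common sur covering. -/
lemma exists_common_covering {S : Scheme.{u}} {α : Type v} [Finite α] {X Y : PSch S}
    (f : α → (X ⟶ Y)) : ∃ (Z : Over S) (p : Z ⟶ X.toOver) (a : α → (Z ⟶ Y.toOver)),
      IsSurCovering p ∧ ∀ i, geomMap (ptsMap p) ≫ (f i).1 = geomMap (ptsMap (a i)) := by
  classical
  have := Fintype.ofFinite α
  have h (s : Finset α) : ∃ (Z : Over S) (p : Z ⟶ X.toOver), IsSurCovering p ∧
      ∀ i ∈ s, ∃ a : Z ⟶ Y.toOver, geomMap (ptsMap p) ≫ (f i).1 = geomMap (ptsMap a) := by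
    induction s using Finset.induction_on with
    | empty => exact ⟨_, _, .id _, by simp⟩
    | insert i s _ ih =>
      obtain ⟨Z, p, hp, h⟩ := ih
      obtain ⟨Z', p', a', hp', h'⟩ := (f i).2
      obtain ⟨a', rfl⟩ := uliftYoneda.{u + 1}.map_surjective a'
      obtain ⟨Z'', q, q', hq, e⟩ := hp'.exists_pullback p
      refine ⟨Z'', q ≫ p, hq.comp hp, fun j hj ↦ ?_⟩
      obtain rfl | hj := Finset.mem_insert.mp hj
      · refine ⟨q' ≫ a', ?_⟩
        rw [e]
        simp only [ptsMap, geomMap, Functor.map_comp, Functor.whiskerLeft_comp, Category.assoc]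
          at h' ⊢
        rw [h']
      · obtain ⟨a, ha⟩ := h j hj
        refine ⟨q ≫ a, ?_⟩
        simp only [ptsMap, geomMap, Functor.map_comp, Functor.whiskerLeft_comp, Category.assoc]
          at ha ⊢
        rw [ha]
  obtain ⟨Z, p, hp, h⟩ := h Finset.univ
  choose a ha using fun i ↦ h i (Finset.mem_univ i)
  exact ⟨Z, p, a, hp, ha⟩

end PSchemes

namespace PSchemes

/-! ### The quotient of a disjoint union of affine varieties -/

/-- A P-action on a disjoint union of affine schemes locally of finite type is induced by morphisms
on a sur covering which is quasi-compact. -/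
lemma exists_quasiCompact_covering {S : Scheme.{u}} {ι : Type u} {V : ι → Over S}
    (hV : ∀ i, IsAffine (V i).left) {G : Type v} [Group G] [Finite G]
    (ρ : PAction G (disjUnion V)) :
    ∃ (Z : Over S) (a : G → (Z ⟶ (disjUnion V).toOver)), IsSurCovering (a 1) ∧
      QuasiCompact (a 1).left ∧
      ∀ g, geomMap (ptsMap (a 1)) ≫ (ρ g).hom.1 = geomMap (ptsMap (a g)) := by
  classical
  obtain ⟨Z, p, a, ⟨_, _⟩, ha⟩ := exists_common_covering fun g ↦ (ρ g).hom
  obtain ⟨O, hO, hO'⟩ := exists_opens_quasiCompact p.left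
    (fun i ↦ (disjUnionι V i).left.opensRange) (fun i ↦ isAffineOpen_opensRange _)
    (fun i j hij ↦ disjoint_opensRange_sigmaι (fun i ↦ (V i).left) i j hij)
    (sigmaOpenCover fun i ↦ (V i).left).iSup_opensRange
  let o : Over.mk (O.ι ≫ Z.hom) ⟶ Z := Over.homMk O.ι
  -- The chosen `a 1` agrees with `p` only on geometric points; replacing it by `p` makes the
  -- covering itself the morphism for `1`.
  refine ⟨Over.mk (O.ι ≫ Z.hom), Function.update (fun g ↦ o ≫ a g) 1 (o ≫ p), ?_, ?_, fun g ↦ ?_⟩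
  · rw [Function.update_self]
    exact ⟨inferInstanceAs (LocallyOfFinitePresentation (O.ι ≫ p.left)), hO⟩
  · rw [Function.update_self]
    exact hO'
  · rw [Function.update_self]
    obtain rfl | hg := eq_or_ne g 1
    · rw [Function.update_self, map_one]
      exact Category.comp_id _
    · rw [Function.update_of_ne hg]
      have := ha g
      simp only [ptsMap, geomMap, Functor.map_comp, Functor.whiskerLeft_comp, Category.assoc]
        at this ⊢
      rw [this]

/-- The index of the member of a disjoint union on which a point lies. -/
noncomputable def memberIndex {S : Scheme.{u}} {ι : Type u} {V : ι → Over S}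
    (x : (disjUnion V).toOver.left) : ι :=
  (exists_disjUnionι_eq x).choose

lemma memberIndex_eq_iff {S : Scheme.{u}} {ι : Type u} {V : ι → Over S}
    {x : (disjUnion V).toOver.left} {i : ι} :
    memberIndex x = i ↔ x ∈ (disjUnionι V i).left.opensRange := by
  obtain ⟨y, hy⟩ := (exists_disjUnionι_eq x).choose_spec
  constructor
  · rintro rfl
    exact ⟨y, hy⟩
  · rintro ⟨y', hy'⟩
    exact eq_of_disjUnionι_eq (hy.trans hy'.symm)

lemma isLocallyConstant_memberIndex {S : Scheme.{u}} {ι : Type u} {V : ι → Over S} :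
    IsLocallyConstant (memberIndex : (disjUnion V).toOver.left → ι) := by
  rw [IsLocallyConstant.iff_isOpen_fiber]
  intro i
  convert (disjUnionι V i).left.opensRange.isOpen using 1
  ext x
  exact memberIndex_eq_iff

open Classical in
/-- The set of indices of the members of a disjoint union met by the points `a g z`. -/
noncomputable def orbitType {S : Scheme.{u}} {ι : Type u} {V : ι → Over S} {G : Type v} [Fintype G]
    {Z : Over S} (a : G → (Z ⟶ (disjUnion V).toOver)) (z : Z.left) : Finset ι :=
  Finset.univ.image fun g ↦ memberIndex ((a g).left z)

lemma isLocallyConstant_orbitType {S : Scheme.{u}} {ι : Type u} {V : ι → Over S} {G : Type v}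
    [Fintype G] {Z : Over S} (a : G → (Z ⟶ (disjUnion V).toOver)) :
    IsLocallyConstant (orbitType a) := by
  classical
  rw [IsLocallyConstant.iff_eventually_eq]
  intro z
  have h (g : G) := (IsLocallyConstant.iff_eventually_eq _).mp
    (isLocallyConstant_memberIndex.comp_continuous (a g).left.continuous) z
  filter_upwards [Filter.eventually_all.mpr h] with y hy
  exact congrArg (fun f : G → ι ↦ Finset.univ.image f) (funext hy)

/-- Indexing the quotient by finite subsets of `ι` preserves finiteness and countability of the
index type. -/
theorem exists_isGeometricQuotient_disjUnion {k : Type u} [Field k] {ι : Type u}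
    {V : ι → Over (Spec (.of k))} (hV : ∀ i, IsAffine (V i).left ∧ LocallyOfFiniteType (V i).hom)
    {G : Type v} [Group G] [Finite G] (ρ : PAction G (disjUnion V)) :
    ∃ W : Finset ι → Over (Spec (.of k)),
      (∀ J, IsAffine (W J).left ∧ LocallyOfFiniteType (W J).hom) ∧
      ∃ π : disjUnion V ⟶ disjUnion W, IsGeometricQuotient ρ π := by
  classical
  have := Fintype.ofFinite G
  have hX : LocallyOfFiniteType (disjUnion V).toOver.hom :=
    locallyOfFiniteType_disjUnion fun i ↦ (hV i).2
  obtain ⟨Z, a, ha₁, hqc, ha⟩ := exists_quasiCompact_covering (fun i ↦ (hV i).1) ρ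
  have hZ : LocallyOfFiniteType Z.hom := by
    have := ha₁.locallyOfFinitePresentation
    rw [← Over.w (a 1)]
    infer_instance
  have hρ (K) (t : Over.mk K.str ⟶ Z) (g : G) : (ρ g).hom.1.app K ⟨t ≫ a 1⟩ = ⟨t ≫ a g⟩ :=
    ConcreteCategory.congr_hom (NatTrans.congr_app (ha g) K) ⟨t⟩
  have hmul (K : ACF (Spec (.of k))) (t t' : Over.mk K.str ⟶ Z) (g : G)
      (hg : t ≫ a g = t' ≫ a 1) (h : G) : t' ≫ a h = t ≫ a (h * g) := by
    apply ULift.up_injective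
    refine (hρ K t' h).symm.trans (Eq.trans ?_ (hρ K t (h * g)))
    have e : (ρ (h * g)).hom.1.app K ⟨t ≫ a 1⟩ =
        (ρ h).hom.1.app K ((ρ g).hom.1.app K ⟨t ≫ a 1⟩) := by
      rw [map_mul]
      rfl
    refine Eq.trans ?_ e.symm
    exact congrArg ((ρ h).hom.1.app K) ((hρ K t g).trans (congrArg ULift.up hg)).symm
  -- Points in one orbit give families that differ by right translation of `G`, so they lie in the
  -- same piece `D J`.
  have hmem (K : ACF (Spec (.of k))) (t t' : Over.mk K.str ⟶ Z) (g : G)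
      (h : ∀ h, t' ≫ a h = t ≫ a (h * g)) :
      orbitType a (t.left (IsLocalRing.closedPoint K.carrier)) =
        orbitType a (t'.left (IsLocalRing.closedPoint K.carrier)) := by
    have e (j : G) : (a j).left (t'.left (IsLocalRing.closedPoint K.carrier)) =
        (a (j * g)).left (t.left (IsLocalRing.closedPoint K.carrier)) :=
      congrArg (fun f ↦ f.left (IsLocalRing.closedPoint K.carrier)) (h j)
    ext i
    simp only [orbitType, Finset.mem_image, Finset.mem_univ, true_and, e]
    exact (Equiv.mulRight g).surjective.exists
  let D (J : Finset ι) : Z.left.Opens :=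
    ⟨orbitType a ⁻¹' {J}, (isLocallyConstant_orbitType a).isOpen_fiber J⟩
  let U (J : Finset ι) : (disjUnion V).toOver.left.Opens :=
    ⨆ i ∈ (J : Set ι), (disjUnionι V i).left.opensRange
  have hDU (J : Finset ι) (g : G) (z : Z.left) (hz : z ∈ D J) : (a g).left z ∈ U J := by
    obtain rfl : orbitType a z = J := hz
    simp only [U, TopologicalSpace.Opens.mem_iSup]
    exact ⟨_, Finset.mem_coe.mpr (Finset.mem_image_of_mem _ (Finset.mem_univ g)),
      memberIndex_eq_iff.mp rfl⟩
  have hU (J : Finset ι) : IsAffineOpen (U J) := by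
    have := fun i ↦ (hV i).1
    exact .biSup_of_disjoint J.finite_toSet (fun i _ ↦ isAffineOpen_opensRange _)
      fun i _ j _ hij ↦ disjoint_opensRange_sigmaι (fun i ↦ (V i).left) i j hij
  let T (J : Finset ι) : Over (Spec (.of k)) := Over.mk ((D J).ι ≫ Z.hom)
  let d (J : Finset ι) : T J ⟶ Z := Over.homMk (D J).ι
  let u (J : Finset ι) : Over.mk ((U J).ι ≫ (disjUnion V).toOver.hom) ⟶ (disjUnion V).toOver :=
    Over.homMk (U J).ι
  have hb (J : Finset ι) (g : G) : ∃ b : T J ⟶ Over.mk ((U J).ι ≫ (disjUnion V).toOver.hom),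
      b ≫ u J = d J ≫ a g := by
    have hr : Set.range ((D J).ι ≫ (a g).left) ⊆ Set.range (U J).ι := by
      rintro _ ⟨z, rfl⟩
      rw [Scheme.Opens.range_ι]
      exact hDU J g z.1 z.2
    have h := IsOpenImmersion.lift_fac (U J).ι _ hr
    refine ⟨Over.homMk (IsOpenImmersion.lift (U J).ι _ hr) ?_, Over.OverMorphism.ext h⟩
    simp only [Over.mk_hom, T]
    rw [reassoc_of% h, Over.w]
  choose b hb using hb
  have key (J : Finset ι) := by
    have : IsAffine (Over.mk ((U J).ι ≫ (disjUnion V).toOver.hom)).left := hU J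
    have : LocallyOfFiniteType (Over.mk ((U J).ι ≫ (disjUnion V).toOver.hom)).hom :=
      inferInstanceAs (LocallyOfFiniteType ((U J).ι ≫ (disjUnion V).toOver.hom))
    have : LocallyOfFiniteType (T J).hom :=
      inferInstanceAs (LocallyOfFiniteType ((D J).ι ≫ Z.hom))
    have : CompactSpace (T J).left := by
      -- `D J` is closed in the preimage under `a 1` of the affine open `U J`, and that preimage is
      -- compact because `a 1` is quasi-compact.
      have hD : IsCompact (D J : Set Z.left) := .of_isClosed_subset
        ((a 1).left.isCompact_preimage (U := U J) (hU J).isCompact)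
        ((isLocallyConstant_orbitType a).isClosed_fiber J) fun z hz ↦ hDU J 1 z hz
      exact isCompact_iff_compactSpace.mp hD
    exact exists_affine_orbitSpace (b J)
  choose W T' r q hWa hWf hT'f hr hq hsep using key
  refine ⟨W, fun J ↦ ⟨hWa J, hWf J⟩, ?_⟩
  refine exists_isGeometricQuotient ρ (Z := (disjUnion T').toOver)
    (p := disjUnionDesc fun J ↦ r J ≫ d J ≫ a 1) (q := disjUnionDesc fun J ↦ q J ≫ disjUnionι W J)
    (isSurCovering_of_locallyOfFiniteType _ (locallyOfFiniteType_disjUnion hT'f) hX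
      (surjective_disjUnionDesc fun x ↦ ?_))
    (isSurCovering_of_locallyOfFiniteType _ (locallyOfFiniteType_disjUnion hT'f)
      (locallyOfFiniteType_disjUnion hWf) (surjective_disjUnionDesc fun w ↦ ?_)) fun K z z' ↦ ?_
  · obtain ⟨z, rfl⟩ := ha₁.surjective.surj x
    obtain ⟨t, ht⟩ := (hr (orbitType a z)).surj (⟨z, rfl⟩ : D (orbitType a z))
    exact ⟨_, t, congrArg (fun y : D (orbitType a z) ↦ (a 1).left y.1) ht⟩
  · obtain ⟨J, w, rfl⟩ := exists_disjUnionι_eq w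
    obtain ⟨t, rfl⟩ := (hq J).surj w
    exact ⟨J, t, rfl⟩
  · obtain ⟨J, z, rfl⟩ := exists_comp_disjUnionι_eq z
    obtain ⟨J', z', rfl⟩ := exists_comp_disjUnionι_eq z'
    have hp (J) (z : Over.mk K.str ⟶ T' J) :
        (z ≫ disjUnionι T' J) ≫ disjUnionDesc (fun J ↦ r J ≫ d J ≫ a 1) =
          (z ≫ r J ≫ d J) ≫ a 1 := by
      simp only [Category.assoc, disjUnionι_desc]
    have hrel (g : G) := Eq.congr
      ((congrArg (fun x ↦ (ρ g).hom.1.app K ⟨x⟩) (hp J z)).trans (hρ K (z ≫ r J ≫ d J) g))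
      (congrArg ULift.up (hp J' z'))
    refine Iff.trans ?_ (exists_congr fun g ↦ ((hrel g).trans ULift.up_injective.eq_iff).symm)
    change _ ↔ ∃ g, (z ≫ r J ≫ d J) ≫ a g = (z' ≫ r J' ≫ d J') ≫ a 1
    have hJ (J) (z : Over.mk K.str ⟶ T' J) :
        orbitType a ((z ≫ r J ≫ d J).left (IsLocalRing.closedPoint K.carrier)) = J :=
      ((z ≫ r J).left (IsLocalRing.closedPoint K.carrier)).2
    have hb' (J) (z z' : Over.mk K.str ⟶ T' J) (g h : G) : z ≫ r J ≫ b J g = z' ≫ r J ≫ b J h ↔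
        z ≫ r J ≫ d J ≫ a g = z' ≫ r J ≫ d J ≫ a h := by
      rw [← hb, ← hb]
      refine ⟨fun h ↦ by rw [reassoc_of% h], fun h ↦ Over.OverMorphism.ext ?_⟩
      rw [← cancel_mono (U J).ι]
      have h := over_hom_eq_iff.mp h
      simp only [Over.comp_left, Category.assoc] at h ⊢
      exact h
    simp only [Category.assoc, disjUnionι_desc] at hb' ⊢
    constructor
    · intro h
      obtain rfl : J = J' :=
        eq_of_comp_disjUnionι_eq (y := z ≫ q J) (y' := z' ≫ q J') (by simpa using h)
      -- Matching the member `j = 1` of the second family already puts both points in one orbit.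
      obtain ⟨g, hg⟩ := (hsep J K z z').2 (comp_disjUnionι_injective (by simpa using h)) 1
      exact ⟨g, (hb' J z z' g 1).mp hg⟩
    · rintro ⟨g, hg⟩
      have hh := hmul K (z ≫ r J ≫ d J) (z' ≫ r J' ≫ d J') g (by simpa using hg)
      obtain rfl : J = J' := by
        rw [← hJ J z, ← hJ J' z']
        exact hmem K _ _ g hh
      simp only [Category.assoc] at hh
      have := (hsep J K z z').1 (Equiv.mulRight g) fun h ↦ (hb' _ _ _ _ _).mpr (hh h).symm
      rw [reassoc_of% this]

end PSchemes

namespace PSchemes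

/-! ### Decomposition into affine varieties -/

/-- A closed subset of an affine open is the image of a monomorphism of finite type from an affine
scheme. -/
lemma exists_affine_mono_range_eq {X : Scheme.{u}} {U : X.Opens} (hU : IsAffineOpen U) {C : Set X}
    (hC : IsClosed C) : ∃ (V : Scheme.{u}) (f : V ⟶ X), IsAffine V ∧ LocallyOfFiniteType f ∧
      Mono f ∧ Set.range f = (U : Set X) ∩ C := by
  -- The vanishing ideal puts the reduced closed subscheme structure on `C` inside the affine `U`.
  let I : Ideal Γ(X, U) := PrimeSpectrum.vanishingIdeal (hU.fromSpec ⁻¹' C)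
  have hs : Function.Surjective (CommRingCat.ofHom (Ideal.Quotient.mk I)).hom :=
    Ideal.Quotient.mk_surjective
  let c := Spec.map (CommRingCat.ofHom (Ideal.Quotient.mk I))
  have : IsClosedImmersion c := IsClosedImmersion.spec_of_surjective _ hs
  have : LocallyOfFiniteType c := locallyOfFiniteType_SpecMap (.of_surjective _ hs)
  refine ⟨_, c ≫ hU.fromSpec, inferInstance, inferInstance, inferInstance, ?_⟩
  have hc : Set.range c = hU.fromSpec ⁻¹' C := by
    refine (range_comap_of_surjective _ _ hs).trans ?_
    rw [CommRingCat.hom_ofHom, Ideal.mk_ker, PrimeSpectrum.zeroLocus_vanishingIdeal_eq_closure]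
    exact (hC.preimage hU.fromSpec.continuous).closure_eq
  rw [← hU.range_fromSpec, ← Set.image_preimage_eq_range_inter, ← hc, ← Set.range_comp]
  rfl

/-- A scheme locally of finite type with an affine open cover indexed by `ι` is P-isomorphic to
a disjoint union of affine varieties indexed by `ι`. -/
lemma exists_iso_disjUnion {k : Type u} [Field k] (X : PSch (Spec (.of k)))
    (hX : LocallyOfFiniteType X.toOver.hom) {ι : Type u} (U : ι → X.toOver.left.Opens)
    (hU : ∀ i, IsAffineOpen (U i)) (hc : ∀ x, ∃ i, x ∈ U i) :
    ∃ V : ι → Over (Spec (.of k)),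
      (∀ i, IsAffine (V i).left ∧ LocallyOfFiniteType (V i).hom) ∧ Nonempty (X ≅ disjUnion V) := by
  -- Well-order `ι`: the `i`-th piece is `U i` minus all earlier members, so each point lies in just
  -- the piece of its least index.
  have hC (i : ι) : IsClosed (⋃ j ∈ {j | WellOrderingRel j i}, (U j : Set X.toOver.left))ᶜ :=
    (isOpen_biUnion fun j _ ↦ (U j).isOpen).isClosed_compl
  choose V f hV hf hm hr using fun i ↦ exists_affine_mono_range_eq (hU i) (hC i)
  have hr' (i x) : x ∈ Set.range (f i) ↔ x ∈ U i ∧ ∀ j, WellOrderingRel j i → x ∉ U j := by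
    rw [hr]
    simp
  have hV' (i) : LocallyOfFiniteType (Over.mk (f i ≫ X.toOver.hom)).hom :=
    inferInstanceAs (LocallyOfFiniteType (f i ≫ X.toOver.hom))
  refine ⟨fun i ↦ Over.mk (f i ≫ X.toOver.hom), fun i ↦ ⟨hV i, hV' i⟩, ?_⟩
  let F (i : ι) : Over.mk (f i ≫ X.toOver.hom) ⟶ X.toOver := Over.homMk (f i)
  have hs : Surjective (disjUnionDesc F).left := surjective_disjUnionDesc fun x ↦ by
    have hwf : WellFounded (WellOrderingRel : ι → ι → Prop) := IsWellFounded.wf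
    obtain ⟨x', hx'⟩ := (hr' (hwf.min {i | x ∈ U i} (hc x)) x).mpr
      ⟨hwf.min_mem {i | x ∈ U i} (hc x), fun j hj hx ↦ hwf.not_lt_min _ hx hj⟩
    exact ⟨_, x', hx'⟩
  obtain ⟨e⟩ := (isSurCovering_of_locallyOfFiniteType _ (locallyOfFiniteType_disjUnion hV') hX
    hs).nonempty_iso fun K y y' h ↦ by
      obtain ⟨i, y, rfl⟩ := exists_comp_disjUnionι_eq y
      obtain ⟨j, y', rfl⟩ := exists_comp_disjUnionι_eq y'
      simp only [Category.assoc, disjUnionι_desc] at h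
      have h := over_hom_eq_iff.mp h
      have hi : (y.left ≫ f i) (IsLocalRing.closedPoint K.carrier) ∈ Set.range (f i) := ⟨_, rfl⟩
      have hj : (y.left ≫ f i) (IsLocalRing.closedPoint K.carrier) ∈ Set.range (f j) :=
        ⟨y'.left (IsLocalRing.closedPoint K.carrier),
          (congrArg (fun f ↦ f (IsLocalRing.closedPoint K.carrier)) h).symm⟩
      rw [hr'] at hi hj
      obtain hij | rfl | hij := trichotomous_of WellOrderingRel i j
      · exact (hj.2 i hij hi.1).elim
      · congr 1
        apply Over.OverMorphism.ext
        rw [← cancel_mono (f i)]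
        exact h
      · exact (hi.2 j hij hj.1).elim
  exact ⟨e.symm⟩

end PSchemes

/-! ### Existence of the quotient and descent of countability -/

open PSchemes in
theorem mainTheorem5 {k : Type u} [Field k] {G : Type v} [Group G] [Finite G]
    (X : PSch (Spec (CommRingCat.of k))) (hX : LocallyOfFiniteType X.toOver.hom)
    (ρ : PAction G X) :
    (∃ (Y : PSch (Spec (CommRingCat.of k))) (π : X ⟶ Y),
      IsStrongPQuotient ρ π ∧ LocallyOfFiniteType Y.toOver.hom ∧
        (QuasiCompact X.toOver.hom → QuasiCompact Y.toOver.hom)) ∧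
    (IsCountableUnionOfAffineVarieties X →
      ∀ (Y : PSch (Spec (CommRingCat.of k))) (π : X ⟶ Y),
        IsStrongPQuotient ρ π → IsCountableUnionOfAffineVarieties Y) := by
  constructor
  · obtain ⟨ι, U, hU, hc, hι⟩ : ∃ (ι : Type u) (U : ι → X.toOver.left.Opens),
        (∀ i, IsAffineOpen (U i)) ∧ (∀ x, ∃ i, x ∈ U i) ∧
        (QuasiCompact X.toOver.hom → Finite ι) := by
      -- A finite affine cover is chosen when there is one, so that the index type `Finset ι` of the
      -- quotient is finite too.
      by_cases h : QuasiCompact X.toOver.hom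
      · have : CompactSpace X.toOver.left := QuasiCompact.compactSpace_of_compactSpace X.toOver.hom
        let 𝒰 := X.toOver.left.affineCover.finiteSubcover
        exact ⟨𝒰.I₀, fun i ↦ (𝒰.f i).opensRange, fun i ↦ isAffineOpen_opensRange _,
          fun x ↦ ⟨_, 𝒰.covers x⟩, fun _ ↦ inferInstance⟩
      · exact ⟨X.toOver.left.affineOpens, fun U ↦ U.1, fun U ↦ U.2, fun x ↦ by
          obtain ⟨U, hU, hx, -⟩ := exists_isAffineOpen_mem_and_subset
            (TopologicalSpace.Opens.mem_top x)
          exact ⟨⟨U, hU⟩, hx⟩, fun h' ↦ (h h').elim⟩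
    obtain ⟨V, hV, ⟨e⟩⟩ := exists_iso_disjUnion X hX U hU hc
    obtain ⟨W, hW, π, hπ⟩ := exists_isGeometricQuotient_disjUnion hV
      (e.conjAut.toMonoidHom.comp ρ)
    refine ⟨disjUnion W, e.hom ≫ π, hπ.of_iso.isStrongPQuotient,
      locallyOfFiniteType_disjUnion fun J ↦ (hW J).2, fun h ↦ ?_⟩
    have := hι h
    have := compactSpace_disjUnion (V := W) fun J ↦ have := (hW J).1; inferInstance
    rwa [quasiCompact_iff_compactSpace]
  · rintro ⟨ι, V, hι, hV, ⟨e⟩⟩ Y π hπ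
    obtain ⟨W, hW, π', hπ'⟩ := exists_isGeometricQuotient_disjUnion hV
      (e.conjAut.toMonoidHom.comp ρ)
    exact ⟨Finset ι, W, inferInstance, hW, hπ.nonempty_iso hπ'.of_iso.isStrongPQuotient⟩
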